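/- **Proposition 2.** Single-sample OSO can outperform the mean-based certainty-equivalent (CE) resolving heuristic by an unbounded factor. *Setting.* In an online resource allocation problem with horizon $T$, supply nodes $\mathcal J$ and resources $\mathcal K$ with capacities $b_k$, item $t=1,\dots,T$ has rewards $r^t_j$ and consumptions $A^t_{jk}$, where the pairs $(r^t,A^t)$ are i.i.d. from a known law $\mathcal D$. Each item is irrevocably rejected or assigned to one supply node, and total consumption of each resource $k$ must not exceed $b_k$. $\mathbb E[\mathrm{OPT}]$ denotes the expected optimum of the offline integer program. In period $t$, a resolving heuristic observes item $t$, forms a forecast of items $t+1,\dots,T$, solves the integer program consisting of item $t$ and the forecast items with the residual capacities, implements the decision on item $t$, and discards the rest. Single-sample OSO forecasts by one fresh i.i.d. sample path from $\mathcal D$; CE replaces every future item by the mean item $(\mathbb E[r],\mathbb E[A])$. Both use an exact (possibly randomized) integer programming solver. The solver of OSO is equivariant: permuting the items permutes the (law of the) returned solution in the same way. The solver of CE is arbitrary if $T$ is a perfect square; for other $T$, it rejects the current item whenever some optimal solution does. *Instance.* For $d>2$ and $T>d^2$, let $|\mathcal J|=1$, let there be $d$ resources of capacity $B=\sqrt T$,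 and let all rewards equal $1$. Each item has consumption vector $e_k$ with probability $1/\sqrt T$ for each $k=1,\dots,d$, and the all-ones vector with the remaining probability $1-d/\sqrt T$. Let $\mathrm{CE}$ and $\mathrm{OSO}$ be the total rewards of the two heuristics. Then: 1. For every $d>2$ and every $M<d$ there is $T_0$ such that for all $T\ge T_0$ with $T>d^2$: $\mathbb E[\mathrm{CE}]>0$ and $\mathbb E[\mathrm{OSO}]\ge M\cdot\mathbb E[\mathrm{CE}]$. Hence the ratio is unbounded as $d$ grows. 2. The competitive ratio of CE is at most $1/d$: for every $d>2$, $\rho>1/d$ and $\alpha\in\mathbb R$ there is $T_0$ such that $\mathbb E[\mathrm{CE}]<\rho\cdot\mathbb E[\mathrm{OPT}]-\alpha$ for all $T\ge T_0$ with $T>d^2$. 3. OSO has competitive ratio $1-\varepsilon_{d,T,B}$: for all $d>2$, $T>d^2$ and $\varepsilon\in(0,0.001]$ with $\sqrt T\ge 1024\,\log\frac{2dT}{\varepsilon}\cdot\frac{\log^3(1/\varepsilon)}{\varepsilon^2}$, $\mathbb E[\mathrm{OSO}]\ge(1-\varepsilon)\,\mathbb E[\mathrm{OPT}]$. Moreover,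 there is a universal constant $C>0$ such that, for all $d>2$ and $T>d^2$, $\mathbb E[\mathrm{OSO}]\ge\bigl(1-C\sqrt{\log(dT)/B}\bigr)\,\mathbb E[\mathrm{OPT}]$ with $B=\sqrt T$. In parts 1 and 2, $T_0$ does not depend on the solvers. -/

import Mathlib

noncomputable section

namespace OnlineAllocation

/-- An item of a resource allocation problem with supply nodes `J` and resources `K`: its reward at
each supply node, and its consumption of each resource when it is assigned to a supply node. -/
structure Item (J K : Type) where
  reward : J → ℝ
  use : J → K → ℝ

/-- The reward of a decision on one item: `none` rejects it, `some j` assigns it to node `j`. -/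
def Item.gain {J K : Type} (a : Item J K) : Option J → ℝ
  | none => 0
  | some j => a.reward j

/-- The resource consumption of a decision on one item. -/
def Item.load {J K : Type} (a : Item J K) : Option J → K → ℝ
  | none => fun _ => 0
  | some j => a.use j

/-- The reward of the decisions `x` on the items `a`. -/
def totalGain {J K : Type} {n : ℕ} (a : Fin n → Item J K) (x : Fin n → Option J) : ℝ :=
  ∑ i, (a i).gain (x i)

/-- The decisions `x` on the items `a` respect the resource capacities `c`. -/
def Feasible {J K : Type} {n : ℕ} (a : Fin n → Item J K) (c : K → ℝ) (x : Fin n → Option J) :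
    Prop :=
  ∀ k, ∑ i, (a i).load (x i) k ≤ c k

/-- `x` is an optimal solution of the integer program with items `a` and capacities `c`. -/
def IsOptimal {J K : Type} {n : ℕ} (a : Fin n → Item J K) (c : K → ℝ) (x : Fin n → Option J) :
    Prop :=
  Feasible a c x ∧ ∀ y, Feasible a c y → totalGain a y ≤ totalGain a x

/-- The optimal value of the integer program with items `a` and capacities `c`. -/
def optValue {J K : Type} {n : ℕ} (a : Fin n → Item J K) (c : K → ℝ) : ℝ :=
  sSup (totalGain a '' {x | Feasible a c x})

/-- A (possibly randomized) solver of the integer programs: for all items and capacities, the law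
of the solution that it returns. -/
def Solver (J K : Type) : Type :=
  ∀ n : ℕ, (Fin n → Item J K) → (K → ℝ) → PMF (Fin n → Option J)

/-- The solver returns an optimal solution of every feasible program. -/
def Solver.IsExact {J K : Type} (s : Solver J K) : Prop :=
  ∀ (n : ℕ) (a : Fin n → Item J K) (c : K → ℝ), (∃ y, Feasible a c y) →
    ∀ x ∈ (s n a c).support, IsOptimal a c x

/-- When the items are permuted, the solution is permuted in the same way (in law). -/
def Solver.IsEquivariant {J K : Type} (s : Solver J K) : Prop :=
  ∀ (n : ℕ) (σ : Equiv.Perm (Fin n)) (a : Fin n → Item J K) (c : K → ℝ),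
    s n (a ∘ σ) c = (s n a c).map (fun x => x ∘ σ)

/-- The solver rejects the first item whenever some optimal solution does. -/
def Solver.PrefersRejection {J K : Type} (s : Solver J K) : Prop :=
  ∀ (n : ℕ) (a : Fin (n + 1) → Item J K) (c : K → ℝ), (∃ y, IsOptimal a c y ∧ y 0 = none) →
    ∀ x ∈ (s (n + 1) a c).support, x 0 = none

/-- An online resource allocation problem: in each of `horizon` periods one item arrives; the items
are `item ξ` for independent scenarios `ξ` with law `law`. -/
structure Problem (Ξ J K : Type) where
  horizon : ℕ
  law : PMF Ξ
  item : Ξ → Item J K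
  capacity : K → ℝ

/-- The expectation of `f` under a probability law on a finite type. -/
def expect {Ω : Type} [Fintype Ω] (p : PMF Ω) (f : Ω → ℝ) : ℝ :=
  ∑ ω, (p ω).toReal * f ω

/-- The law of `n` independent draws from `p`. -/
def iid {Ξ : Type} (p : PMF Ξ) : (n : ℕ) → PMF (Fin n → Ξ)
  | 0 => PMF.pure Fin.elim0
  | n + 1 => p.bind fun ξ => (iid p n).map fun ζ => Fin.cons ξ ζ

/-- The item whose rewards and consumptions are the expected ones. -/
def Problem.meanItem {Ξ J K : Type} [Fintype Ξ] (P : Problem Ξ J K) : Item J K where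
  reward j := expect P.law fun ξ => (P.item ξ).reward j
  use j k := expect P.law fun ξ => (P.item ξ).use j k

/-- The law of the arrivals and decisions of a resolving heuristic over the last `n` periods, from
the residual capacities `c`. In each period, the heuristic observes the current scenario `ξ`, draws
a forecast `f` of the items of the remaining periods, solves the program made of the current item
and the forecast items, implements the decision on the current item, and discards the rest. -/
def Problem.resolve {Ξ J K : Type} (P : Problem Ξ J K)
    (forecast : (n : ℕ) → PMF (Fin n → Item J K)) (s : Solver J K) :
    (n : ℕ) → (K → ℝ) → PMF (Fin n → Ξ × Option J)
  | 0, _ => PMF.pure Fin.elim0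
  | n + 1, c =>
    P.law.bind fun ξ =>
      (forecast n).bind fun f =>
        (s (n + 1) (Fin.cons (P.item ξ) f) c).bind fun x =>
          (P.resolve forecast s n fun k => c k - (P.item ξ).load (x 0) k).map fun ω =>
            Fin.cons (ξ, x 0) ω

/-- Expected total reward of the resolving heuristic over the whole horizon. -/
def Problem.resolveValue {Ξ J K : Type} [Fintype Ξ] [Fintype J] (P : Problem Ξ J K)
    (forecast : (n : ℕ) → PMF (Fin n → Item J K)) (s : Solver J K) : ℝ :=
  expect (P.resolve forecast s P.horizon P.capacity) fun ω =>
    ∑ t, (P.item (ω t).1).gain (ω t).2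

/-- Expected total reward of single-sample OSO: in each period, the forecast is one fresh sample
path of the remaining periods. -/
def Problem.osoValue {Ξ J K : Type} [Fintype Ξ] [Fintype J] (P : Problem Ξ J K)
    (s : Solver J K) : ℝ :=
  P.resolveValue (fun n => (iid P.law n).map fun ζ i => P.item (ζ i)) s

/-- Expected total reward of the mean-based certainty-equivalent resolving heuristic: all future
parameters are replaced by their expectations. -/
def Problem.ceValue {Ξ J K : Type} [Fintype Ξ] [Fintype J] (P : Problem Ξ J K)
    (s : Solver J K) : ℝ :=
  P.resolveValue (fun _ => PMF.pure fun _ => P.meanItem) s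

/-- Expected hindsight optimum. -/
def Problem.optExpected {Ξ J K : Type} [Fintype Ξ] (P : Problem Ξ J K) : ℝ :=
  expect (iid P.law P.horizon) fun ξ => optValue (fun t => P.item (ξ t)) P.capacity

/-- The scenario law: `some k` with probability `1 / √T` for each `k`, and `none` otherwise. -/
def scenarioLaw (d T : ℕ) (h : d ^ 2 < T) : PMF (Option (Fin d)) :=
  PMF.ofFintype
    (fun o => match o with
      | none => ENNReal.ofReal (1 - d / √(T : ℝ))
      | some _ => ENNReal.ofReal (1 / √(T : ℝ)))
    (by
      have hT : (0 : ℝ) < √(T : ℝ) := Real.sqrt_pos.2 (by exact_mod_cast (Nat.zero_le _).trans_lt h)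
      have hd : (d : ℝ) / √(T : ℝ) ≤ 1 := by
        rw [div_le_one hT]
        exact Real.le_sqrt_of_sq_le (by exact_mod_cast h.le)
      rw [Fintype.sum_option, Finset.sum_const, Finset.card_univ, Fintype.card_fin, nsmul_eq_mul,
        ← ENNReal.ofReal_natCast, ← ENNReal.ofReal_mul (by positivity),
        ← ENNReal.ofReal_add (by linarith) (by positivity), ← ENNReal.ofReal_one]
      congr 1
      ring)

/-- The multidimensional knapsack with `T` periods and `d` resources of capacity `√T`. All rewards
are `1`; an item consumes one unit of resource `k` only, with probability `1 / √T` for each `k`,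
and one unit of every resource otherwise. -/
def knapsack (d T : ℕ) (h : d ^ 2 < T) : Problem (Option (Fin d)) Unit (Fin d) where
  horizon := T
  law := scenarioLaw d T h
  item o :=
    { reward := fun _ => 1
      use := fun _ k => match o with
        | none => 1
        | some l => if k = l then 1 else 0 }
  capacity _ := √(T : ℝ)

end OnlineAllocation

end

/-!
Items that consume a single resource nearly exhaust all the capacities, so the expected optimum is
`d √T - O(d T ^ (1 / 4))`. OSO loses no more than that: the current item and the sampled ones are
exchangeable, so when `n` periods remain, one period of OSO earns in expectation a fraction `1 / n`
of the optimum of the residual problem and depletes a resource of residual capacity `c` at rate at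
most `c / n`. Residual capacities therefore stay proportional to the remaining time up to random
fluctuations, whose cost is bounded by the potential `∑ k, shortfall p n (c k)` with `p = 1 / √T`.

A mean item consumes `μ = 1 - (d - 1) / √T` of every resource, and `√T = √T μ + (d - 1)`. As long
as `√T` mean items are forecast, CE gains nothing from displacing them, and the current item is
accepted only if it fits into the excess capacity `d - 1`; if ties are broken towards rejection, it
is never accepted while `√T / μ` mean items are forecast. In both cases CE earns at most
`√T + O(d ^ 2)`.
-/

namespace OnlineAllocation

section Expect

variable {Ω Ω' Ξ : Type} [Fintype Ω] [Fintype Ω'] [Fintype Ξ]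

theorem sum_toReal_eq_one (p : PMF Ω) : ∑ ω, (p ω).toReal = 1 := by
  rw [← ENNReal.toReal_sum fun ω _ => p.apply_ne_top ω, ← tsum_fintype (L := .unconditional _),
    p.tsum_coe, ENNReal.toReal_one]

theorem expect_const (p : PMF Ω) (a : ℝ) : expect p (fun _ => a) = a := by
  rw [expect, ← Finset.sum_mul, sum_toReal_eq_one, one_mul]

theorem expect_add (p : PMF Ω) (f g : Ω → ℝ) :
    expect p (fun ω => f ω + g ω) = expect p f + expect p g := by
  simp only [expect, mul_add, Finset.sum_add_distrib]

theorem expect_sub (p : PMF Ω) (f g : Ω → ℝ) :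
    expect p (fun ω => f ω - g ω) = expect p f - expect p g := by
  simp only [expect, mul_sub, Finset.sum_sub_distrib]

theorem expect_const_mul (p : PMF Ω) (a : ℝ) (f : Ω → ℝ) :
    expect p (fun ω => a * f ω) = a * expect p f := by
  simp only [expect, Finset.mul_sum, mul_left_comm]

theorem expect_sum {ι : Type} (p : PMF Ω) (S : Finset ι) (f : ι → Ω → ℝ) :
    expect p (fun ω => ∑ i ∈ S, f i ω) = ∑ i ∈ S, expect p (f i) := by
  simp only [expect, Finset.mul_sum]
  exact Finset.sum_comm

theorem expect_mono {p : PMF Ω} {f g : Ω → ℝ} (h : ∀ ω ∈ p.support, f ω ≤ g ω) :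
    expect p f ≤ expect p g := by
  refine Finset.sum_le_sum fun ω _ => ?_
  by_cases hω : ω ∈ p.support
  · exact mul_le_mul_of_nonneg_left (h ω hω) ENNReal.toReal_nonneg
  · rw [(p.apply_eq_zero_iff ω).2 hω, ENNReal.toReal_zero, zero_mul, zero_mul]

theorem expect_le {p : PMF Ω} {f : Ω → ℝ} {a : ℝ} (h : ∀ ω ∈ p.support, f ω ≤ a) :
    expect p f ≤ a :=
  (expect_mono h).trans_eq (expect_const p a)

theorem le_expect {p : PMF Ω} {f : Ω → ℝ} {a : ℝ} (h : ∀ ω ∈ p.support, a ≤ f ω) :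
    a ≤ expect p f :=
  (expect_const p a).symm.trans_le (expect_mono h)

theorem expect_pure (ω : Ω) (f : Ω → ℝ) : expect (PMF.pure ω) f = f ω := by
  classical
  simp [expect, PMF.pure_apply, apply_ite ENNReal.toReal]

theorem expect_bind (p : PMF Ω) (k : Ω → PMF Ω') (f : Ω' → ℝ) :
    expect (p.bind k) f = expect p fun ω => expect (k ω) f := by
  have toReal_bind (b : Ω') : (p.bind k b).toReal = ∑ ω, (p ω).toReal * (k ω b).toReal := by
    rw [PMF.bind_apply, tsum_fintype, ENNReal.toReal_sum fun ω _ =>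
      ENNReal.mul_ne_top (p.apply_ne_top ω) ((k ω).apply_ne_top b)]
    simp only [ENNReal.toReal_mul]
  simp only [expect, toReal_bind, Finset.sum_mul, Finset.mul_sum, mul_assoc]
  exact Finset.sum_comm

theorem expect_map (p : PMF Ω) (k : Ω → Ω') (f : Ω' → ℝ) :
    expect (p.map k) f = expect p fun ω => f (k ω) := by
  rw [← PMF.bind_pure_comp, expect_bind]
  simp only [Function.comp, expect_pure]

theorem sq_expect_le (p : PMF Ω) (f : Ω → ℝ) : expect p f ^ 2 ≤ expect p fun ω => f ω ^ 2 :=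
  Real.pow_arith_mean_le_arith_mean_pow_of_even _ _ _ (fun _ _ => ENNReal.toReal_nonneg)
    (sum_toReal_eq_one p) even_two

theorem min_sub_sqrt_le_expect_min (p : PMF Ω) (f : Ω → ℝ) (m c : ℝ) :
    min m c - √(expect p fun ω => (f ω - m) ^ 2) ≤ expect p fun ω => min (f ω) c := by
  have abs_le : expect p (fun ω => |f ω - m|) ≤ √(expect p fun ω => (f ω - m) ^ 2) := by
    refine Real.le_sqrt_of_sq_le ((sq_expect_le p _).trans_eq ?_)
    simp only [sq_abs]
  calc min m c - √(expect p fun ω => (f ω - m) ^ 2)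
      ≤ min m c - expect p fun ω => |f ω - m| := by gcongr
    _ = expect p fun ω => min m c - |f ω - m| := by rw [expect_sub, expect_const]
    _ ≤ expect p fun ω => min (f ω) c := expect_mono fun ω _ => by
      have := abs_nonneg (f ω - m)
      have := neg_abs_le (f ω - m)
      exact le_min (by linarith [min_le_left m c]) (by linarith [min_le_right m c])

theorem expect_iid_succ (p : PMF Ξ) (n : ℕ) (f : (Fin (n + 1) → Ξ) → ℝ) :
    expect (iid p (n + 1)) f = expect p fun ξ => expect (iid p n) fun ζ => f (Fin.cons ξ ζ) := by
  rw [iid, expect_bind]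
  simp only [expect_map]

theorem iid_apply {Ξ : Type} (p : PMF Ξ) (n : ℕ) (ζ : Fin n → Ξ) :
    iid p n ζ = ∏ i, p (ζ i) := by
  classical
  induction n with
  | zero => simp [iid, PMF.pure_apply, Subsingleton.elim ζ Fin.elim0]
  | succ n ih =>
    have map_cons (ξ : Ξ) : (iid p n).map (fun η => (Fin.cons ξ η : Fin (n + 1) → Ξ)) ζ =
        if ζ 0 = ξ then iid p n (Fin.tail ζ) else 0 := by
      have cons_eq (η : Fin n → Ξ) : ζ = Fin.cons ξ η ↔ ζ 0 = ξ ∧ η = Fin.tail ζ := by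
        conv_lhs => rw [← Fin.cons_self_tail ζ, Fin.cons_inj, eq_comm (b := η)]
      split_ifs with h <;> simp [PMF.map_apply, cons_eq, h]
    rw [iid, PMF.bind_apply, Fin.prod_univ_succ]
    simp only [map_cons, ih, mul_ite, mul_zero, Fin.tail]
    rw [tsum_eq_single (ζ 0) fun ξ hξ => if_neg hξ.symm, if_pos rfl]

theorem expect_iid_perm (p : PMF Ξ) {n : ℕ} (σ : Equiv.Perm (Fin n)) (f : (Fin n → Ξ) → ℝ) :
    expect (iid p n) (fun ζ => f (ζ ∘ σ)) = expect (iid p n) f := by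
  refine Fintype.sum_equiv (σ.symm.arrowCongr (Equiv.refl Ξ)) _ _ fun ζ => ?_
  have harrow : σ.symm.arrowCongr (Equiv.refl Ξ) ζ = ζ ∘ σ := rfl
  rw [harrow, iid_apply, iid_apply]
  simp only [Function.comp, Equiv.prod_comp σ fun i => p (ζ i)]

theorem expect_iid_sum (p : PMF Ξ) (n : ℕ) (g : Ξ → ℝ) :
    expect (iid p n) (fun ζ => ∑ i, g (ζ i)) = n * expect p g := by
  induction n with
  | zero => simp [expect_const]
  | succ n ih =>
    rw [expect_iid_succ]
    simp only [Fin.sum_univ_succ, Fin.cons_zero, Fin.cons_succ, expect_add, expect_const, ih]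
    push_cast
    ring

theorem expect_iid_sum_sq {p : PMF Ξ} {g : Ξ → ℝ} (hg : expect p g = 0) (n : ℕ) :
    expect (iid p n) (fun ζ => (∑ i, g (ζ i)) ^ 2) = n * expect p fun ξ => g ξ ^ 2 := by
  induction n with
  | zero => simp [expect_const]
  | succ n ih =>
    rw [expect_iid_succ]
    simp only [Fin.sum_univ_succ, Fin.cons_zero, Fin.cons_succ, add_sq, expect_add, expect_const,
      ih, expect_const_mul, expect_iid_sum, hg, mul_zero]
    push_cast
    ring

theorem expect_iid_sum_sub_sq_le (p : PMF Ξ) (n : ℕ) (g : Ξ → ℝ) :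
    expect (iid p n) (fun ζ => (∑ i, g (ζ i) - n * expect p g) ^ 2) ≤
      n * expect p fun ξ => g ξ ^ 2 := by
  have centered : expect p (fun ξ => g ξ - expect p g) = 0 := by
    rw [expect_sub, expect_const, sub_self]
  have variance_le : expect p (fun ξ => (g ξ - expect p g) ^ 2) ≤ expect p fun ξ => g ξ ^ 2 := by
    have expand (ξ : Ξ) : (g ξ - expect p g) ^ 2 =
        g ξ ^ 2 + (expect p g ^ 2 - 2 * expect p g * g ξ) := by ring
    simp only [expand, expect_add, expect_sub, expect_const, expect_const_mul]
    linarith [sq_nonneg (expect p g)]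
  calc expect (iid p n) (fun ζ => (∑ i, g (ζ i) - n * expect p g) ^ 2)
      = expect (iid p n) (fun ζ => (∑ i, (g (ζ i) - expect p g)) ^ 2) := by simp
    _ = n * expect p (fun ξ => (g ξ - expect p g) ^ 2) := expect_iid_sum_sq centered n
    _ ≤ n * expect p fun ξ => g ξ ^ 2 := by gcongr

theorem min_sub_sqrt_le_expect_iid_min_sum (p : PMF Ξ) (n : ℕ) (g : Ξ → ℝ) (c : ℝ) :
    min (n * expect p g) c - √(n * expect p fun ξ => g ξ ^ 2) ≤
      expect (iid p n) fun ζ => min (∑ i, g (ζ i)) c :=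
  calc min (n * expect p g) c - √(n * expect p fun ξ => g ξ ^ 2)
      ≤ min (n * expect p g) c -
          √(expect (iid p n) fun ζ => (∑ i, g (ζ i) - n * expect p g) ^ 2) := by
        gcongr
        exact expect_iid_sum_sub_sq_le p n g
    _ ≤ expect (iid p n) fun ζ => min (∑ i, g (ζ i)) c := min_sub_sqrt_le_expect_min _ _ _ _

end Expect

section Programs

variable {J K : Type} {n : ℕ} {a : Fin n → Item J K} {c : K → ℝ}

theorem feasible_none (a : Fin n → Item J K) (hc : ∀ k, 0 ≤ c k) :
    Feasible a c fun _ => none := by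
  simpa [Feasible, Item.load] using hc

theorem exists_isOptimal [Finite J] (h : ∃ y, Feasible a c y) : ∃ x, IsOptimal a c x := by
  obtain ⟨x, hx, hmax⟩ := Set.exists_max_image {x | Feasible a c x} (totalGain a)
    (Set.toFinite _) h
  exact ⟨x, hx, hmax⟩

theorem IsOptimal.optValue_eq {x : Fin n → Option J} (h : IsOptimal a c x) :
    optValue a c = totalGain a x :=
  IsGreatest.csSup_eq ⟨⟨x, h.1, rfl⟩, by rintro _ ⟨y, hy, rfl⟩; exact h.2 y hy⟩

theorem Feasible.totalGain_le_optValue [Finite J] {y : Fin n → Option J} (hy : Feasible a c y) :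
    totalGain a y ≤ optValue a c := by
  obtain ⟨x, hx⟩ := exists_isOptimal ⟨y, hy⟩
  exact (hx.2 y hy).trans_eq hx.optValue_eq.symm

theorem Item.load_nonneg {b : Item J K} (hb : ∀ j k, 0 ≤ b.use j k) (x : Option J) (k : K) :
    0 ≤ b.load x k := by
  cases x with
  | none => exact le_rfl
  | some j => exact hb j k

theorem Item.load_le_one {b : Item J K} (hb : ∀ j k, b.use j k ≤ 1) (x : Option J) (k : K) :
    b.load x k ≤ 1 := by
  cases x with
  | none => exact zero_le_one
  | some j => exact hb j k

theorem Feasible.load_le {x : Fin n → Option J} (hx : Feasible a c x)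
    (ha : ∀ i j k, 0 ≤ (a i).use j k) (i : Fin n) (k : K) : (a i).load (x i) k ≤ c k :=
  (Finset.single_le_sum (f := fun i => (a i).load (x i) k)
    (fun i _ => Item.load_nonneg (ha i) (x i) k) (Finset.mem_univ i)).trans (hx k)

end Programs

namespace Problem

variable {Ξ J K : Type} (P : Problem Ξ J K)

section Resolve

variable {forecast : (n : ℕ) → PMF (Fin n → Item J K)} {s : Solver J K} {n : ℕ} {c : K → ℝ}

/-- The reward of a realized sequence of scenarios and decisions. -/
def totalReward (ω : Fin n → Ξ × Option J) : ℝ :=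
  ∑ t, (P.item (ω t).1).gain (ω t).2

theorem totalReward_cons (ξ : Ξ) (x : Option J) (ω : Fin n → Ξ × Option J) :
    P.totalReward (Fin.cons (ξ, x) ω : Fin (n + 1) → Ξ × Option J) =
      (P.item ξ).gain x + P.totalReward ω := by
  simp [totalReward, Fin.sum_univ_succ]

theorem mem_support_resolve_succ {ω : Fin (n + 1) → Ξ × Option J} :
    ω ∈ (P.resolve forecast s (n + 1) c).support ↔
      ∃ ξ ∈ P.law.support, ∃ f ∈ (forecast n).support,
        ∃ x ∈ (s (n + 1) (Fin.cons (P.item ξ) f) c).support,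
          ∃ ω' ∈ (P.resolve forecast s n fun k => c k - (P.item ξ).load (x 0) k).support,
            Fin.cons (ξ, x 0) ω' = ω := by
  simp only [resolve, PMF.mem_support_bind_iff, PMF.mem_support_map_iff]

/-- The expected reward of a resolving heuristic over the last `n` periods, from the residual
capacities `c`. -/
noncomputable def valueFrom [Fintype Ξ] [Fintype J] (forecast : (n : ℕ) → PMF (Fin n → Item J K))
    (s : Solver J K) (n : ℕ) (c : K → ℝ) : ℝ :=
  expect (P.resolve forecast s n c) P.totalReward

/-- The expected hindsight optimum over `n` periods with capacities `c`. -/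
noncomputable def optFrom [Fintype Ξ] (n : ℕ) (c : K → ℝ) : ℝ :=
  expect (iid P.law n) fun ζ => optValue (fun t => P.item (ζ t)) c

/-- The forecast of single-sample OSO: one sample path of the future items. -/
noncomputable def sampleForecast (n : ℕ) : PMF (Fin n → Item J K) :=
  (iid P.law n).map fun ζ i => P.item (ζ i)

/-- The forecast of the certainty-equivalent heuristic: every future item is the mean item. -/
noncomputable def meanForecast [Fintype Ξ] (n : ℕ) : PMF (Fin n → Item J K) :=
  PMF.pure fun _ => P.meanItem

end Resolve

section Sampling

variable [Fintype Ξ] [Fintype J] {s : Solver J K} {n : ℕ} {c : K → ℝ}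

/-- The expectation of `f ζ x` when `ζ` are `n` sampled scenarios and `x` is the solution that the
solver returns for their items. -/
noncomputable def sampleExpect (s : Solver J K) (n : ℕ) (c : K → ℝ)
    (f : (Fin n → Ξ) → (Fin n → Option J) → ℝ) : ℝ :=
  expect (iid P.law n) fun ζ => expect (s n (fun i => P.item (ζ i)) c) (f ζ)

theorem sampleExpect_mono (hs : s.IsExact) (hc : ∀ k, 0 ≤ c k)
    {f g : (Fin n → Ξ) → (Fin n → Option J) → ℝ}
    (h : ∀ ζ x, IsOptimal (fun i => P.item (ζ i)) c x → f ζ x ≤ g ζ x) :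
    P.sampleExpect s n c f ≤ P.sampleExpect s n c g :=
  expect_mono fun ζ _ => expect_mono fun x hx =>
    h ζ x (hs n _ c ⟨_, feasible_none _ hc⟩ x hx)

theorem sampleExpect_const (s : Solver J K) (n : ℕ) (c : K → ℝ) (b : ℝ) :
    P.sampleExpect s n c (fun _ _ => b) = b := by
  simp only [sampleExpect, expect_const]

theorem sampleExpect_totalGain (hs : s.IsExact) (hc : ∀ k, 0 ≤ c k) :
    P.sampleExpect s n c (fun ζ x => ∑ i, (P.item (ζ i)).gain (x i)) = P.optFrom n c := by
  have hopt : P.sampleExpect s n c (fun ζ _ => optValue (fun i => P.item (ζ i)) c) =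
      P.optFrom n c := by
    simp only [sampleExpect, expect_const, optFrom]
  rw [← hopt]
  exact le_antisymm (P.sampleExpect_mono hs hc fun ζ x hx => hx.optValue_eq.ge)
    (P.sampleExpect_mono hs hc fun ζ x hx => hx.optValue_eq.le)

theorem sampleExpect_apply (hs : s.IsEquivariant) (g : Ξ → Option J → ℝ) (i : Fin (n + 1)) :
    P.sampleExpect s (n + 1) c (fun ζ x => g (ζ i) (x i)) =
      P.sampleExpect s (n + 1) c fun ζ x => g (ζ 0) (x 0) := by
  rw [sampleExpect, sampleExpect, ← expect_iid_perm P.law (Equiv.swap 0 i)]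
  congr 1 with ζ
  have hsolver : s (n + 1) (fun j => P.item ((ζ ∘ Equiv.swap 0 i) j)) c =
      (s (n + 1) (fun j => P.item (ζ j)) c).map fun x => x ∘ Equiv.swap 0 i :=
    hs (n + 1) (Equiv.swap 0 i) (fun j => P.item (ζ j)) c
  rw [hsolver, expect_map]
  simp

theorem mul_sampleExpect_zero (hs : s.IsEquivariant) (g : Ξ → Option J → ℝ) :
    (n + 1) * P.sampleExpect s (n + 1) c (fun ζ x => g (ζ 0) (x 0)) =
      P.sampleExpect s (n + 1) c fun ζ x => ∑ i, g (ζ i) (x i) := by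
  have hsum : P.sampleExpect s (n + 1) c (fun ζ x => ∑ i, g (ζ i) (x i)) =
      ∑ i, P.sampleExpect s (n + 1) c fun ζ x => g (ζ i) (x i) := by
    simp only [sampleExpect, expect_sum]
  simp [hsum, P.sampleExpect_apply hs]

theorem sampleExpect_gain_zero (hs : s.IsExact) (hs' : s.IsEquivariant) (hc : ∀ k, 0 ≤ c k) :
    P.sampleExpect s (n + 1) c (fun ζ x => (P.item (ζ 0)).gain (x 0)) =
      P.optFrom (n + 1) c / (n + 1) := by
  rw [eq_div_iff (by positivity), mul_comm,
    P.mul_sampleExpect_zero hs' fun ξ => (P.item ξ).gain, P.sampleExpect_totalGain hs hc]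

theorem sampleExpect_load_zero_le (hs : s.IsExact) (hs' : s.IsEquivariant) (hc : ∀ k, 0 ≤ c k)
    (k : K) :
    P.sampleExpect s (n + 1) c (fun ζ x => (P.item (ζ 0)).load (x 0) k) ≤ c k / (n + 1) := by
  rw [le_div_iff₀ (by positivity), mul_comm,
    P.mul_sampleExpect_zero hs' fun ξ x => (P.item ξ).load x k]
  exact (P.sampleExpect_mono hs hc fun ζ x hx => hx.1 k).trans_eq
    (P.sampleExpect_const s (n + 1) c (c k))

theorem valueFrom_sampleForecast_succ (s : Solver J K) (n : ℕ) (c : K → ℝ) :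
    P.valueFrom P.sampleForecast s (n + 1) c =
      P.sampleExpect s (n + 1) c fun ζ x => (P.item (ζ 0)).gain (x 0) +
        P.valueFrom P.sampleForecast s n fun k => c k - (P.item (ζ 0)).load (x 0) k := by
  have item_cons (ξ : Ξ) (ζ : Fin n → Ξ) :
      (Fin.cons (P.item ξ) fun i => P.item (ζ i) : Fin (n + 1) → Item J K) =
        fun i => P.item ((Fin.cons ξ ζ : Fin (n + 1) → Ξ) i) :=
    (Fin.comp_cons P.item ξ ζ).symm
  rw [sampleExpect, expect_iid_succ, valueFrom, resolve]
  simp only [sampleForecast, PMF.bind_map, Function.comp, expect_bind, expect_map, item_cons,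
    totalReward_cons, Fin.cons_zero, expect_add, expect_const, valueFrom]

end Sampling

end Problem

section Potential

variable {p : ℝ} {n : ℕ}

/-- The scale `√(n p) + 1` on which a demand of mean `n p`, a sum of `n` independent contributions
of second moment at most `p`, fluctuates. The summand `1` keeps it positive and absorbs the rounding
of capacities. -/
noncomputable def fluctuation (p : ℝ) (n : ℕ) : ℝ :=
  √(n * p) + 1

/-- The potential of a residual capacity `c` when the expected demand of the `n` remaining periods
is `n * p`. It vanishes when the capacity covers the demand. -/
noncomputable def shortfall (p : ℝ) (n : ℕ) (c : ℝ) : ℝ :=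
  max (n * p - c) 0 ^ 2 / (2 * fluctuation p n)

theorem fluctuation_pos (p : ℝ) (n : ℕ) : 0 < fluctuation p n := by
  unfold fluctuation
  positivity

theorem mul_fluctuation_succ_le (hp : 0 ≤ p) (n : ℕ) :
    n * fluctuation p (n + 1) ≤ (n + 1) * fluctuation p n := by
  have hsqrt : n * √((n + 1) * p) ≤ (n + 1) * √(n * p) := by
    refine (sq_le_sq₀ (by positivity) (by positivity)).1 ?_
    rw [mul_pow, mul_pow, Real.sq_sqrt (by positivity), Real.sq_sqrt (by positivity)]
    have : 0 ≤ (n + 1) * n * p := by positivity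
    linarith
  simp only [fluctuation, Nat.cast_add, Nat.cast_one]
  linarith

theorem add_one_le_fluctuation_mul (hp : 0 ≤ p) (hp1 : p ≤ 1) (n : ℕ) :
    (n + 1) * p + 1 ≤ fluctuation p n * fluctuation p (n + 1) := by
  simp only [fluctuation, Nat.cast_add, Nat.cast_one]
  have hsqrt : √((n + 1) * p) ≤ √(n * p) + 1 := by
    refine Real.sqrt_le_iff.2 ⟨by positivity, ?_⟩
    rw [add_sq, Real.sq_sqrt (by positivity)]
    linarith [Real.sqrt_nonneg (n * p)]
  have hsq : √((n + 1) * p) ^ 2 = (n + 1) * p := Real.sq_sqrt (by positivity)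
  nlinarith [Real.sqrt_nonneg (n * p), Real.sqrt_nonneg ((n + 1) * p)]

theorem sq_shortage_drift_of_le (hp1 : p ≤ 1) {c : ℝ} (hc : 0 ≤ c) (hle : c ≤ (n + 1) * p) :
    (1 - c / (n + 1)) * max (n * p - c) 0 ^ 2 + c / (n + 1) * max (n * p - (c - 1)) 0 ^ 2 ≤
      (n / (n + 1) * max ((n + 1) * p - c) 0) ^ 2 + (p + 1 / (n + 1)) := by
  have max_sq_le (x : ℝ) : max x 0 ^ 2 ≤ x ^ 2 := by
    rw [← sq_abs x]
    gcongr
    exact max_le (le_abs_self x) (abs_nonneg x)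
  have hrate : c / (n + 1) ≤ p := (div_le_iff₀ (by positivity)).2 (by linarith)
  have hone : 0 ≤ 1 - c / (n + 1) := by linarith
  have hinv : (0 : ℝ) ≤ 1 / (n + 1) := by positivity
  rw [max_eq_left (sub_nonneg.2 hle)]
  calc (1 - c / (n + 1)) * max (n * p - c) 0 ^ 2 + c / (n + 1) * max (n * p - (c - 1)) 0 ^ 2
      ≤ (1 - c / (n + 1)) * (n * p - c) ^ 2 + c / (n + 1) * (n * p - (c - 1)) ^ 2 :=
        add_le_add (mul_le_mul_of_nonneg_left (max_sq_le _) hone)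
          (mul_le_mul_of_nonneg_left (max_sq_le _) (by positivity))
    _ = (n / (n + 1) * ((n + 1) * p - c)) ^ 2 + (c / (n + 1) - (c / (n + 1)) ^ 2) := by
        field_simp
        ring
    _ ≤ (n / (n + 1) * ((n + 1) * p - c)) ^ 2 + (p + 1 / (n + 1)) := by
        linarith [sq_nonneg (c / (n + 1))]

theorem sq_shortage_drift_of_ge (hp : 0 ≤ p) {c : ℝ} (hge : (n + 1) * p ≤ c) :
    (1 - c / (n + 1)) * max (n * p - c) 0 ^ 2 + c / (n + 1) * max (n * p - (c - 1)) 0 ^ 2 ≤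
      p + 1 / (n + 1) := by
  rw [max_eq_right (by linarith : n * p - c ≤ 0), zero_pow two_ne_zero, mul_zero, zero_add]
  rcases le_total c ((n + 1) * p + 1) with hle | hgt
  · have hmax : max (n * p - (c - 1)) 0 ^ 2 ≤ 1 :=
      pow_le_one₀ (le_max_right _ _) (max_le (by linarith) zero_le_one)
    have hrate : 0 ≤ c / (n + 1) := div_nonneg (le_trans (by positivity) hge) (by positivity)
    calc c / (n + 1) * max (n * p - (c - 1)) 0 ^ 2 ≤ c / (n + 1) * 1 := by gcongr
      _ ≤ ((n + 1) * p + 1) / (n + 1) * 1 := by gcongr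
      _ = p + 1 / (n + 1) := by field_simp
  · rw [max_eq_right (by linarith), zero_pow two_ne_zero, mul_zero]
    positivity

/-- One period of the squared shortage of a residual capacity `c` that is depleted by `1` with
probability `c / (n + 1)`. -/
theorem sq_shortage_drift (hp : 0 ≤ p) (hp1 : p ≤ 1) (n : ℕ) {c : ℝ} (hc : 0 ≤ c) :
    (1 - c / (n + 1)) * max (n * p - c) 0 ^ 2 + c / (n + 1) * max (n * p - (c - 1)) 0 ^ 2 ≤
      (n / (n + 1) * max ((n + 1) * p - c) 0) ^ 2 + (p + 1 / (n + 1)) := by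
  rcases le_total c ((n + 1) * p) with hle | hge
  · exact sq_shortage_drift_of_le hp1 hc hle
  · exact (sq_shortage_drift_of_ge hp hge).trans (le_add_of_nonneg_left (sq_nonneg _))

theorem sq_div_fluctuation_succ_le (hp : 0 ≤ p) (n : ℕ) (u : ℝ) :
    (n / (n + 1) * u) ^ 2 / (2 * fluctuation p n) ≤
      n / (n + 1) * u ^ 2 / (2 * fluctuation p (n + 1)) := by
  have hμ := fluctuation_pos p n
  have hν := fluctuation_pos p (n + 1)
  have hratio : n / (n + 1) * fluctuation p (n + 1) ≤ fluctuation p n := by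
    rw [div_mul_eq_mul_div, div_le_iff₀ (by positivity), mul_comm (fluctuation p n)]
    exact mul_fluctuation_succ_le hp n
  rw [div_le_div_iff₀ (by positivity) (by positivity)]
  calc (n / (n + 1) * u) ^ 2 * (2 * fluctuation p (n + 1))
      = 2 * (n / (n + 1) * u ^ 2) * (n / (n + 1) * fluctuation p (n + 1)) := by ring
    _ ≤ 2 * (n / (n + 1) * u ^ 2) * fluctuation p n := by gcongr
    _ = n / (n + 1) * u ^ 2 * (2 * fluctuation p n) := by ring

theorem noise_div_fluctuation_le (hp : 0 ≤ p) (hp1 : p ≤ 1) (n : ℕ) :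
    (p + 1 / (n + 1)) / (2 * fluctuation p n) ≤ fluctuation p (n + 1) / (2 * (n + 1)) := by
  have hμ := fluctuation_pos p n
  rw [div_le_div_iff₀ (by positivity) (by positivity)]
  calc (p + 1 / (n + 1)) * (2 * (n + 1)) = 2 * ((n + 1) * p + 1) := by field_simp
    _ ≤ 2 * (fluctuation p n * fluctuation p (n + 1)) :=
        mul_le_mul_of_nonneg_left (add_one_le_fluctuation_mul hp hp1 n) zero_le_two
    _ = fluctuation p (n + 1) * (2 * fluctuation p n) := by ring

theorem shortfall_anti (p : ℝ) (n : ℕ) {c c' : ℝ} (h : c ≤ c') :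
    shortfall p n c' ≤ shortfall p n c := by
  have := fluctuation_pos p n
  unfold shortfall
  gcongr

theorem shortfall_sub_le {c l : ℝ} (hl : 0 ≤ l) (hl1 : l ≤ 1) :
    shortfall p n (c - l) ≤
      shortfall p n c + l * (shortfall p n (c - 1) - shortfall p n c) := by
  have hfluct := fluctuation_pos p n
  have hmax : max (n * p - (c - l)) 0 ≤
      (1 - l) * max (n * p - c) 0 + l * max (n * p - (c - 1)) 0 := by
    have : 0 ≤ 1 - l := by linarith
    refine max_le ?_ (by positivity)
    calc n * p - (c - l) = (1 - l) * (n * p - c) + l * (n * p - (c - 1)) := by ring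
      _ ≤ _ := by gcongr <;> exact le_max_left _ _
  have hsq : max (n * p - (c - l)) 0 ^ 2 ≤
      (1 - l) * max (n * p - c) 0 ^ 2 + l * max (n * p - (c - 1)) 0 ^ 2 :=
    calc max (n * p - (c - l)) 0 ^ 2
        ≤ ((1 - l) * max (n * p - c) 0 + l * max (n * p - (c - 1)) 0) ^ 2 := by gcongr
      _ ≤ _ := (convexOn_pow 2).2 (le_max_right _ _) (le_max_right _ _) (by linarith) hl (by ring)
  calc shortfall p n (c - l)
      ≤ ((1 - l) * max (n * p - c) 0 ^ 2 + l * max (n * p - (c - 1)) 0 ^ 2) /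
          (2 * fluctuation p n) := by
        unfold shortfall
        gcongr
    _ = _ := by
        unfold shortfall
        ring

theorem shortfall_step (hp : 0 ≤ p) (hp1 : p ≤ 1) (n : ℕ) {c q : ℝ} (hc : 0 ≤ c)
    (hq : q ≤ c / (n + 1)) :
    shortfall p n c + q * (shortfall p n (c - 1) - shortfall p n c) ≤
      shortfall p (n + 1) c - max ((n + 1) * p - c) 0 / (n + 1) +
        fluctuation p (n + 1) / (n + 1) := by
  have hμ := fluctuation_pos p n
  have hν := fluctuation_pos p (n + 1)
  have hdepletion : 0 ≤ shortfall p n (c - 1) - shortfall p n c :=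
    sub_nonneg.2 (shortfall_anti p n (by linarith))
  have hdrift := sq_shortage_drift hp hp1 n hc
  simp only [shortfall, Nat.cast_add, Nat.cast_one] at hdepletion ⊢
  set u := max ((n + 1) * p - c) 0
  have hcontract := sq_div_fluctuation_succ_le hp n u
  have hnoise := noise_div_fluctuation_le hp hp1 n
  set μ := fluctuation p n
  set ν := fluctuation p (n + 1)
  have hsquare : 0 ≤ (u - ν) ^ 2 / (2 * ν * (n + 1)) := by positivity
  calc _ ≤ max (n * p - c) 0 ^ 2 / (2 * μ) + c / (n + 1) *
          (max (n * p - (c - 1)) 0 ^ 2 / (2 * μ) - max (n * p - c) 0 ^ 2 / (2 * μ)) := by gcongr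
    _ = ((1 - c / (n + 1)) * max (n * p - c) 0 ^ 2 +
          c / (n + 1) * max (n * p - (c - 1)) 0 ^ 2) / (2 * μ) := by ring
    _ ≤ ((n / (n + 1) * u) ^ 2 + (p + 1 / (n + 1))) / (2 * μ) := by gcongr
    _ ≤ n / (n + 1) * u ^ 2 / (2 * ν) + ν / (2 * (n + 1)) + (u - ν) ^ 2 / (2 * ν * (n + 1)) := by
        rw [add_div]
        linarith
    _ = u ^ 2 / (2 * ν) - u / (n + 1) + ν / (n + 1) := by
        field_simp
        ring

/-- A lower bound for the expected amount of a resource with per-period demand `p` that OSO turns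
into reward over `n` periods, when the capacity covers the demand. The harmonic number comes from
the summand `1` of `fluctuation`. -/
noncomputable def osoRate (p : ℝ) (n : ℕ) : ℝ :=
  n * p - 4 * √(n * p) - 2 * (harmonic n : ℝ)

theorem osoRate_succ_le (hp : 0 ≤ p) (n : ℕ) :
    osoRate p (n + 1) ≤ osoRate p n + p - 2 * (fluctuation p (n + 1) / (n + 1)) := by
  have hsqrt : √((n + 1) * p) / (n + 1) ≤ 2 * (√((n + 1) * p) - √(n * p)) := by
    have hN : (0 : ℝ) < n + 1 := by positivity
    have hle : 2 * (√(n * p) * √((n + 1) * p)) ≤ (2 * n + 1) * p := by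
      have h := two_mul_le_add_sq (√(n * p)) (√((n + 1) * p))
      rw [Real.sq_sqrt (by positivity), Real.sq_sqrt (by positivity)] at h
      linarith
    rcases hp.eq_or_lt with rfl | hp
    · simp
    have hpos : 0 < √((n + 1) * p) := by positivity
    have hsq : √((n + 1) * p) ^ 2 = (n + 1) * p := Real.sq_sqrt (by positivity)
    refine le_of_mul_le_mul_right ?_ hpos
    rw [div_mul_eq_mul_div, ← pow_two, hsq, mul_div_cancel_left₀ _ hN.ne']
    linarith
  simp only [osoRate, fluctuation, harmonic_succ]
  push_cast
  rw [add_div, ← one_div]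
  linarith

theorem osoRate_sub_shortfall_succ_le (hp : 0 ≤ p) (hp1 : p ≤ 1) (n : ℕ) {c q : ℝ} (hc : 0 ≤ c)
    (hq : q ≤ c / (n + 1)) :
    osoRate p (n + 1) - shortfall p (n + 1) c ≤
      (min ((n + 1) * p) c - fluctuation p (n + 1)) / (n + 1) +
        (osoRate p n - (shortfall p n c + q * (shortfall p n (c - 1) - shortfall p n c))) := by
  have hmin : min ((n + 1) * p) c = (n + 1) * p - max ((n + 1) * p - c) 0 := by
    rcases le_total ((n + 1) * p) c with h | h <;> simp [h]
  have hsplit : (min ((n + 1) * p) c - fluctuation p (n + 1)) / (n + 1) =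
      p - max ((n + 1) * p - c) 0 / (n + 1) - fluctuation p (n + 1) / (n + 1) := by
    rw [hmin]
    field_simp
  linarith [shortfall_step hp hp1 n hc hq, osoRate_succ_le hp n]

end Potential

namespace Problem

variable {Ξ J K : Type} [Fintype Ξ] [Fintype J] [Fintype K] {P : Problem Ξ J K}

/-- One period of OSO earns in expectation a fraction `1 / (n + 1)` of the hindsight optimum, and
depletes a resource of capacity `c` by at most `c / (n + 1)`. -/
theorem sum_osoRate_sub_shortfall_succ_le {s : Solver J K} {p : ℝ} (hp : 0 ≤ p) (hp1 : p ≤ 1)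
    (huse : ∀ ξ j k, (P.item ξ).use j k ∈ Set.Icc 0 1) (hs : s.IsExact) (hs' : s.IsEquivariant)
    {n : ℕ} {c : K → ℝ} (hc : ∀ k, 0 ≤ c k)
    (hopt : ∑ k, (min ((n + 1) * p) (c k) - fluctuation p (n + 1)) ≤ P.optFrom (n + 1) c) :
    ∑ k, (osoRate p (n + 1) - shortfall p (n + 1) (c k)) ≤
      P.sampleExpect s (n + 1) c fun ζ x => (P.item (ζ 0)).gain (x 0) +
        ∑ k, (osoRate p n - shortfall p n (c k - (P.item (ζ 0)).load (x 0) k)) := by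
  let Δ (k : K) : ℝ := shortfall p n (c k - 1) - shortfall p n (c k)
  let load (k : K) : ℝ := P.sampleExpect s (n + 1) c fun ζ x => (P.item (ζ 0)).load (x 0) k
  have hload (k : K) : load k ≤ c k / (n + 1) := P.sampleExpect_load_zero_le hs hs' hc k
  have hgain : ∑ k, (min ((n + 1) * p) (c k) - fluctuation p (n + 1)) / (n + 1) ≤
      P.sampleExpect s (n + 1) c fun ζ x => (P.item (ζ 0)).gain (x 0) := by
    rw [P.sampleExpect_gain_zero hs hs' hc, ← Finset.sum_div]
    gcongr
  calc ∑ k, (osoRate p (n + 1) - shortfall p (n + 1) (c k))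
      ≤ ∑ k, ((min ((n + 1) * p) (c k) - fluctuation p (n + 1)) / (n + 1) +
          (osoRate p n - (shortfall p n (c k) + load k * Δ k))) :=
        Finset.sum_le_sum fun k _ => osoRate_sub_shortfall_succ_le hp hp1 n (hc k) (hload k)
    _ ≤ P.sampleExpect s (n + 1) c (fun ζ x => (P.item (ζ 0)).gain (x 0)) +
          ∑ k, (osoRate p n - (shortfall p n (c k) + load k * Δ k)) := by
        rw [Finset.sum_add_distrib]
        gcongr
    _ = P.sampleExpect s (n + 1) c fun ζ x => (P.item (ζ 0)).gain (x 0) +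
          ∑ k, (osoRate p n - (shortfall p n (c k) + (P.item (ζ 0)).load (x 0) k * Δ k)) := by
        simp only [load, sampleExpect, mul_comm _ (Δ _), expect_add, expect_sum, expect_sub,
          expect_const, expect_const_mul]
    _ ≤ _ := P.sampleExpect_mono hs hc fun ζ x _ => by
        gcongr with k
        exact shortfall_sub_le (Item.load_nonneg (fun j k => (huse (ζ 0) j k).1) _ k)
          (Item.load_le_one (fun j k => (huse (ζ 0) j k).2) _ k)

theorem sum_osoRate_sub_shortfall_le {s : Solver J K} {p : ℝ} (hp : 0 ≤ p) (hp1 : p ≤ 1)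
    (huse : ∀ ξ j k, (P.item ξ).use j k ∈ Set.Icc 0 1) (hs : s.IsExact) (hs' : s.IsEquivariant)
    (hopt : ∀ (n : ℕ) (c : K → ℝ), (∀ k, 0 ≤ c k) →
      ∑ k, (min (n * p) (c k) - fluctuation p n) ≤ P.optFrom n c)
    (n : ℕ) {c : K → ℝ} (hc : ∀ k, 0 ≤ c k) :
    ∑ k, (osoRate p n - shortfall p n (c k)) ≤ P.valueFrom P.sampleForecast s n c := by
  induction n generalizing c with
  | zero =>
    have hzero : ∑ k, (osoRate p 0 - shortfall p 0 (c k)) = 0 := by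
      simp [osoRate, shortfall, hc]
    simp [hzero, valueFrom, resolve, totalReward, expect_pure]
  | succ n ih =>
    have hopt' : ∑ k, (min ((n + 1) * p) (c k) - fluctuation p (n + 1)) ≤ P.optFrom (n + 1) c := by
      exact_mod_cast hopt (n + 1) c hc
    refine (sum_osoRate_sub_shortfall_succ_le hp hp1 huse hs hs' hc hopt').trans ?_
    rw [valueFrom_sampleForecast_succ]
    refine P.sampleExpect_mono hs hc fun ζ x hx => add_le_add_right (ih fun k => ?_) _
    exact sub_nonneg.2 (hx.1.load_le (fun i j k => (huse (ζ i) j k).1) 0 k)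

end Problem

theorem exists_finset_card_fiber_eq {ι κ : Type*} [Fintype ι] [DecidableEq κ] (f : ι → κ)
    {m : κ → ℕ} (hm : ∀ k, m k ≤ (Finset.univ.filter fun i => f i = k).card) :
    ∃ A : Finset ι, ∀ k, (A.filter fun i => f i = k).card = m k := by
  classical
  choose S hS hcard using fun k => Finset.exists_subset_card_eq (hm k)
  refine ⟨Finset.univ.filter fun i => i ∈ S (f i), fun k => ?_⟩
  rw [← hcard k]
  congr 1
  ext i
  have hmem : i ∈ S k → f i = k := fun hi => (Finset.mem_filter.1 (hS k hi)).2
  simp only [Finset.mem_filter, Finset.mem_univ, true_and]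
  exact ⟨fun ⟨hi, hk⟩ => hk ▸ hi, fun hi => ⟨(hmem hi).symm ▸ hi, hmem hi⟩⟩

/-- All rewards are `1`, and an assigned item consumes `0` or `1` of each resource, and `1` of at
least one of them. The knapsack instances are of this form. -/
structure Problem.IsBinaryPacking {Ξ J K : Type} (P : Problem Ξ J K) : Prop where
  reward_eq_one : ∀ ξ j, (P.item ξ).reward j = 1
  use_eq_zero_or_one : ∀ ξ j k, (P.item ξ).use j k = 0 ∨ (P.item ξ).use j k = 1
  exists_use_eq_one : ∀ ξ j, ∃ k, (P.item ξ).use j k = 1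

namespace Problem.IsBinaryPacking

variable {Ξ J K : Type} {P : Problem Ξ J K} (h : P.IsBinaryPacking)
include h

theorem use_mem_Icc (ξ : Ξ) (j : J) (k : K) : (P.item ξ).use j k ∈ Set.Icc 0 1 := by
  rcases h.use_eq_zero_or_one ξ j k with h | h <;> simp [h]

theorem load_eq_zero_or_one (ξ : Ξ) (x : Option J) (k : K) :
    (P.item ξ).load x k = 0 ∨ (P.item ξ).load x k = 1 := by
  cases x with
  | none => exact Or.inl rfl
  | some j => exact h.use_eq_zero_or_one ξ j k

theorem gain_mem_Icc (ξ : Ξ) (x : Option J) : (P.item ξ).gain x ∈ Set.Icc 0 1 := by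
  cases x <;> simp [Item.gain, h.reward_eq_one]

theorem gain_le_sum_load [Fintype K] (ξ : Ξ) (x : Option J) :
    (P.item ξ).gain x ≤ ∑ k, (P.item ξ).load x k := by
  cases x with
  | none => simp [Item.gain, Item.load]
  | some j =>
    obtain ⟨k, hk⟩ := h.exists_use_eq_one ξ j
    calc (P.item ξ).gain (some j) = (P.item ξ).use j k := by rw [hk]; exact h.reward_eq_one ξ j
      _ ≤ ∑ k, (P.item ξ).use j k :=
        Finset.single_le_sum (fun k _ => (h.use_mem_Icc ξ j k).1) (Finset.mem_univ k)

theorem exists_gain_eq_load [Nonempty J] (ξ : Ξ) (x : Option J) :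
    ∃ k, (P.item ξ).gain x = (P.item ξ).load x k := by
  cases x with
  | none =>
    obtain ⟨j⟩ := ‹Nonempty J›
    exact ⟨(h.exists_use_eq_one ξ j).choose, rfl⟩
  | some j =>
    obtain ⟨k, hk⟩ := h.exists_use_eq_one ξ j
    exact ⟨k, (h.reward_eq_one ξ j).trans hk.symm⟩

theorem totalGain_le_sum_capacity [Fintype K] {n : ℕ} {ζ : Fin n → Ξ} {c : K → ℝ}
    {x : Fin n → Option J} (hx : Feasible (fun i => P.item (ζ i)) c x) :
    totalGain (fun i => P.item (ζ i)) x ≤ ∑ k, c k :=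
  calc totalGain (fun i => P.item (ζ i)) x
      ≤ ∑ i, ∑ k, (P.item (ζ i)).load (x i) k :=
        Finset.sum_le_sum fun i _ => h.gain_le_sum_load (ζ i) (x i)
    _ = ∑ k, ∑ i, (P.item (ζ i)).load (x i) k := Finset.sum_comm
    _ ≤ ∑ k, c k := Finset.sum_le_sum fun k _ => hx k

theorem totalReward_nonneg {n : ℕ} (ω : Fin n → Ξ × Option J) : 0 ≤ P.totalReward ω :=
  Finset.sum_nonneg fun t _ => (h.gain_mem_Icc (ω t).1 (ω t).2).1

theorem totalReward_le {n : ℕ} (ω : Fin n → Ξ × Option J) : P.totalReward ω ≤ n :=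
  (Finset.sum_le_sum fun t _ => (h.gain_mem_Icc (ω t).1 (ω t).2).2).trans_eq (by simp)

theorem valueFrom_nonneg [Fintype Ξ] [Fintype J] (forecast : (n : ℕ) → PMF (Fin n → Item J K))
    (s : Solver J K) (n : ℕ) (c : K → ℝ) : 0 ≤ P.valueFrom forecast s n c :=
  le_expect fun ω _ => h.totalReward_nonneg ω

theorem optFrom_le [Fintype Ξ] [Finite J] [Fintype K] (n : ℕ) {c : K → ℝ} (hc : ∀ k, 0 ≤ c k) :
    P.optFrom n c ≤ ∑ k, c k := by
  refine expect_le fun ζ _ => ?_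
  obtain ⟨x, hx⟩ := exists_isOptimal ⟨_, feasible_none (fun i => P.item (ζ i)) hc⟩
  exact hx.optValue_eq.trans_le (h.totalGain_le_sum_capacity hx.1)

theorem optFrom_nonneg [Fintype Ξ] (n : ℕ) (c : K → ℝ) : 0 ≤ P.optFrom n c := by
  refine le_expect fun ζ _ => Real.sSup_nonneg ?_
  rintro _ ⟨x, -, rfl⟩
  exact Finset.sum_nonneg fun i _ => (h.gain_mem_Icc (ζ i) (x i)).1

end Problem.IsBinaryPacking

section Knapsack

variable {d T : ℕ} {hT : d ^ 2 < T}

theorem sqrt_horizon_pos (hT : d ^ 2 < T) : 0 < √(T : ℝ) :=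
  Real.sqrt_pos.2 (by exact_mod_cast (Nat.zero_le _).trans_lt hT)

theorem lt_sqrt_horizon (hT : d ^ 2 < T) : (d : ℝ) < √(T : ℝ) :=
  Real.lt_sqrt_of_sq_lt (by exact_mod_cast hT)

theorem one_le_sqrt_horizon (hT : d ^ 2 < T) : 1 ≤ √(T : ℝ) :=
  Real.one_le_sqrt.2 (by exact_mod_cast (Nat.zero_le _).trans_lt hT)

theorem knapsack_isBinaryPacking (hd : 0 < d) (hT : d ^ 2 < T) :
    (knapsack d T hT).IsBinaryPacking where
  reward_eq_one _ _ := rfl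
  use_eq_zero_or_one o _ k := by
    rcases o with _ | l
    · exact Or.inr rfl
    · exact (ite_eq_or_eq (k = l) (1 : ℝ) 0).symm
  exists_use_eq_one o _ := by
    rcases o with _ | l
    · exact ⟨⟨0, hd⟩, rfl⟩
    · exact ⟨l, if_pos rfl⟩

theorem expect_scenarioLaw (f : Option (Fin d) → ℝ) :
    expect (scenarioLaw d T hT) f =
      (1 - d / √(T : ℝ)) * f none + ∑ k, (√(T : ℝ))⁻¹ * f (some k) := by
  have h : (d : ℝ) / √(T : ℝ) ≤ 1 :=
    (div_le_one (sqrt_horizon_pos hT)).2 (lt_sqrt_horizon hT).le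
  rw [expect, Fintype.sum_option]
  simp only [scenarioLaw, PMF.ofFintype_apply]
  rw [ENNReal.toReal_ofReal (by linarith), ENNReal.toReal_ofReal (by positivity), one_div]

/-- Only items that consume a single resource are accepted. -/
theorem exists_feasible_totalGain_eq {n : ℕ} (ζ : Fin n → Option (Fin d)) {c : Fin d → ℝ}
    (hc : ∀ k, 0 ≤ c k) :
    ∃ y, Feasible (fun i => (knapsack d T hT).item (ζ i)) c y ∧
      totalGain (fun i => (knapsack d T hT).item (ζ i)) y =
        (∑ k, min (Finset.univ.filter fun i => ζ i = some k).card ⌊c k⌋₊ : ℕ) := by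
  let m (o : Option (Fin d)) : ℕ :=
    o.elim 0 fun k => min (Finset.univ.filter fun i => ζ i = some k).card ⌊c k⌋₊
  obtain ⟨A, hA⟩ := exists_finset_card_fiber_eq ζ (m := m) fun o => by
    cases o with
    | none => exact Nat.zero_le _
    | some k => exact min_le_left _ _
  have hsome (i : Fin n) (hi : i ∈ A) : ζ i ≠ none :=
    Finset.filter_eq_empty_iff.1 (Finset.card_eq_zero.1 (hA none)) hi
  refine ⟨fun i => if i ∈ A then some () else none, fun k => ?_, ?_⟩
  · have hload (i : Fin n) : ((knapsack d T hT).item (ζ i)).load (if i ∈ A then some () else none) k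
        = if i ∈ A ∧ ζ i = some k then 1 else 0 := by
      by_cases hi : i ∈ A
      · obtain ⟨l, hl⟩ := Option.ne_none_iff_exists'.1 (hsome i hi)
        simp [hi, hl, Item.load, knapsack, eq_comm]
      · simp [hi, Item.load]
    simp only [hload, Finset.sum_boole]
    have hk : (Finset.univ.filter fun i => i ∈ A ∧ ζ i = some k).card = m (some k) := by
      rw [← hA, ← Finset.filter_filter, Finset.filter_univ_mem]
    rw [hk]
    exact (Nat.cast_le.2 (min_le_right _ _)).trans (Nat.floor_le (hc k))
  · have hgain (i : Fin n) : ((knapsack d T hT).item (ζ i)).gain (if i ∈ A then some () else none) =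
        if i ∈ A then 1 else 0 := by
      split_ifs <;> rfl
    simp only [totalGain, hgain, Finset.sum_boole, Finset.filter_univ_mem]
    rw [Finset.card_eq_sum_card_fiberwise (f := ζ) (t := Finset.univ) (by simp),
      Fintype.sum_option]
    simp only [hA, m, Option.elim, zero_add]

theorem sum_min_card_sub_one_le_optValue {n : ℕ} (ζ : Fin n → Option (Fin d)) {c : Fin d → ℝ}
    (hc : ∀ k, 0 ≤ c k) :
    ∑ k, (min (∑ i, if ζ i = some k then 1 else 0) (c k) - 1) ≤
      optValue (fun i => (knapsack d T hT).item (ζ i)) c := by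
  obtain ⟨y, hy, hgain⟩ := exists_feasible_totalGain_eq (hT := hT) ζ hc
  refine le_trans ?_ (hgain.symm.trans_le hy.totalGain_le_optValue)
  push_cast
  gcongr with k
  rw [Finset.sum_boole, sub_le_iff_le_add, ← min_add_add_right]
  exact min_le_min (by linarith) (Nat.lt_floor_add_one (c k)).le

theorem sum_min_sub_fluctuation_le_optFrom (n : ℕ) {c : Fin d → ℝ} (hc : ∀ k, 0 ≤ c k) :
    ∑ k, (min (n * (√(T : ℝ))⁻¹) (c k) - fluctuation (√(T : ℝ))⁻¹ n) ≤
      (knapsack d T hT).optFrom n c := by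
  have hmin (k : Fin d) : min (n * (√(T : ℝ))⁻¹) (c k) - √(n * (√(T : ℝ))⁻¹) ≤
      expect (iid (scenarioLaw d T hT) n) fun ζ =>
        min (∑ i, if ζ i = some k then 1 else 0) (c k) := by
    have hmean : expect (scenarioLaw d T hT) (fun o => if o = some k then 1 else 0) =
        (√(T : ℝ))⁻¹ := by
      simp [expect_scenarioLaw]
    simpa [hmean] using min_sub_sqrt_le_expect_iid_min_sum (scenarioLaw d T hT) n
      (fun o => if o = some k then 1 else 0) (c k)
  calc ∑ k, (min (n * (√(T : ℝ))⁻¹) (c k) - fluctuation (√(T : ℝ))⁻¹ n)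
      ≤ ∑ k, ((expect (iid (scenarioLaw d T hT) n) fun ζ =>
          min (∑ i, if ζ i = some k then 1 else 0) (c k)) - 1) := by
        refine Finset.sum_le_sum fun k _ => ?_
        rw [fluctuation]
        linarith [hmin k]
    _ = expect (iid (scenarioLaw d T hT) n) fun ζ =>
          ∑ k, (min (∑ i, if ζ i = some k then 1 else 0) (c k) - 1) := by
        simp only [expect_sum, expect_sub, expect_const]
    _ ≤ _ := expect_mono fun ζ _ => sum_min_card_sub_one_le_optValue ζ hc

theorem horizon_mul_inv_sqrt (T : ℕ) : T * (√(T : ℝ))⁻¹ = √(T : ℝ) := by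
  rw [← div_eq_mul_inv, Real.div_sqrt]

theorem le_knapsack_optExpected :
    d * (√(T : ℝ) - √√(T : ℝ) - 1) ≤ (knapsack d T hT).optExpected := by
  refine le_trans (le_of_eq ?_)
    (sum_min_sub_fluctuation_le_optFrom (hT := hT) T fun _ => Real.sqrt_nonneg (T : ℝ))
  simp [fluctuation, knapsack, horizon_mul_inv_sqrt, sub_sub, mul_sub, mul_add]

theorem knapsack_optExpected_le (hd : 0 < d) : (knapsack d T hT).optExpected ≤ d * √(T : ℝ) :=
  ((knapsack_isBinaryPacking hd hT).optFrom_le T fun _ => Real.sqrt_nonneg _).trans_eq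
    (by simp)

theorem le_osoRate_horizon (hT : 0 < T) :
    √(T : ℝ) - 12 * √√(T : ℝ) ≤ osoRate (√(T : ℝ))⁻¹ T := by
  have hlog : Real.log T ≤ 4 * (√√(T : ℝ) - 1) := by
    have h := Real.log_le_sub_one_of_pos (x := √√(T : ℝ)) (by positivity)
    rw [Real.log_sqrt (Real.sqrt_nonneg _), Real.log_sqrt (Nat.cast_nonneg T)] at h
    linarith
  rw [osoRate, horizon_mul_inv_sqrt]
  linarith [harmonic_le_one_add_log T]

theorem le_knapsack_osoValue (hd : 0 < d) {s : Solver Unit (Fin d)} (hs : s.IsExact)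
    (hs' : s.IsEquivariant) :
    d * (√(T : ℝ) - 12 * √√(T : ℝ)) ≤ (knapsack d T hT).osoValue s := by
  have hp1 : (√(T : ℝ))⁻¹ ≤ 1 := inv_le_one_of_one_le₀ (one_le_sqrt_horizon hT)
  have hzero : shortfall (√(T : ℝ))⁻¹ T √(T : ℝ) = 0 := by
    simp [shortfall, horizon_mul_inv_sqrt]
  calc d * (√(T : ℝ) - 12 * √√(T : ℝ)) ≤ d * osoRate (√(T : ℝ))⁻¹ T := by
        gcongr
        exact le_osoRate_horizon ((Nat.zero_le _).trans_lt hT)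
    _ = ∑ _ : Fin d, (osoRate (√(T : ℝ))⁻¹ T - shortfall (√(T : ℝ))⁻¹ T √(T : ℝ)) := by
        simp [hzero]
    _ ≤ _ := Problem.sum_osoRate_sub_shortfall_le (by positivity) hp1
        (knapsack_isBinaryPacking hd hT).use_mem_Icc hs hs'
        (fun n _ => sum_min_sub_fluctuation_le_optFrom n) T fun _ => Real.sqrt_nonneg _

end Knapsack

section CertaintyEquivalent

variable {Ξ J K : Type} {n : ℕ}

/-- The number of forecast items that a solution accepts; the item `0` is the current one. -/
def accepted (y : Fin (n + 1) → Option J) : ℕ :=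
  (Finset.univ.filter fun i : Fin n => (y i.succ).isSome).card

theorem exists_reject_accepted_eq [Nonempty J] {m : ℕ} (hm : m ≤ n) :
    ∃ y : Fin (n + 1) → Option J, y 0 = none ∧ accepted y = m := by
  obtain ⟨j⟩ := ‹Nonempty J›
  refine ⟨Fin.cons none fun i => if i < m then some j else none, rfl, ?_⟩
  simp [accepted, apply_ite Option.isSome, Fin.card_filter_val_lt, hm]

/-- The program solved by the certainty-equivalent heuristic: the current item, followed by copies
of the mean item. -/
noncomputable def Problem.meanProgram [Fintype Ξ] (P : Problem Ξ J K) (ξ : Ξ) (n : ℕ) :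
    Fin (n + 1) → Item J K :=
  Fin.cons (P.item ξ) fun _ => P.meanItem

namespace Problem

variable {P : Problem Ξ J K}

theorem mem_support_resolve_meanForecast_succ [Fintype Ξ] {s : Solver J K} {c : K → ℝ}
    {ω : Fin (n + 1) → Ξ × Option J} :
    ω ∈ (P.resolve P.meanForecast s (n + 1) c).support ↔
      ∃ ξ ∈ P.law.support, ∃ x ∈ (s (n + 1) (P.meanProgram ξ n) c).support,
        ∃ ω' ∈ (P.resolve P.meanForecast s n fun k => c k - (P.item ξ).load (x 0) k).support,
          Fin.cons (ξ, x 0) ω' = ω := by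
  rw [mem_support_resolve_succ]
  simp only [meanForecast, PMF.support_pure, Set.mem_singleton_iff, exists_eq_left]
  rfl

theorem feasible_meanProgram_iff [Fintype Ξ] {μ : ℝ} (hμ : ∀ j k, P.meanItem.use j k = μ) {ξ : Ξ}
    {c : K → ℝ} {y : Fin (n + 1) → Option J} :
    Feasible (P.meanProgram ξ n) c y ↔ ∀ k, (P.item ξ).load (y 0) k + accepted y * μ ≤ c k := by
  refine forall_congr' fun k => ?_
  have hmean (x : Option J) : P.meanItem.load x k = (if x.isSome then 1 else 0) * μ := by
    cases x <;> simp [Item.load, hμ]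
  simp only [Fin.sum_univ_succ, meanProgram, Fin.cons_zero, Fin.cons_succ, hmean,
    ← Finset.sum_mul, Finset.sum_boole, accepted]

namespace IsBinaryPacking

variable (h : P.IsBinaryPacking)
include h

theorem totalGain_meanProgram [Fintype Ξ] (ξ : Ξ) (y : Fin (n + 1) → Option J) :
    totalGain (P.meanProgram ξ n) y = (P.item ξ).gain (y 0) + accepted y := by
  have hmean (x : Option J) : P.meanItem.gain x = if x.isSome then 1 else 0 := by
    cases x <;> simp [Item.gain, meanItem, h.reward_eq_one, expect_const]
  simp [totalGain, Fin.sum_univ_succ, meanProgram, hmean, accepted]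

theorem exists_load_eq_natCast (ξ : Ξ) (x : Option J) (k : K) :
    ∃ m : ℕ, (P.item ξ).load x k = m := by
  rcases h.load_eq_zero_or_one ξ x k with h | h
  exacts [⟨0, by simp [h]⟩, ⟨1, by simp [h]⟩]

/-- If `e k = 0`, then accepting an item that uses resource `k` leaves room for at most
`B - 1 / μ < B - 1` mean items, whereas rejecting it leaves room for `B` of them. -/
theorem load_le_of_isOptimal [Fintype Ξ] [Nonempty J] {μ : ℝ}
    (hμ : ∀ j k, P.meanItem.use j k = μ) (hμ0 : 0 ≤ μ) (hμ1 : μ < 1) {B : ℕ} (hB : B ≤ n)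
    {e : K → ℕ} {ξ : Ξ} {x : Fin (n + 1) → Option J}
    (hx : IsOptimal (P.meanProgram ξ n) (fun k => B * μ + e k) x) (k : K) :
    (P.item ξ).load (x 0) k ≤ e k := by
  rcases h.load_eq_zero_or_one ξ (x 0) k with hload | hload
  · rw [hload]
    positivity
  by_contra! hlt
  have he : e k = 0 := by
    rw [hload] at hlt
    exact Nat.lt_one_iff.1 (by exact_mod_cast hlt)
  obtain ⟨y, hy0, hy⟩ := exists_reject_accepted_eq (J := J) hB
  have hreject : (B : ℝ) ≤ (P.item ξ).gain (x 0) + accepted x := by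
    have hfeas : Feasible (P.meanProgram ξ n) (fun k => B * μ + e k) y :=
      (feasible_meanProgram_iff hμ).2 fun k => by simp [hy0, hy, Item.load]
    simpa [h.totalGain_meanProgram, hy0, hy, Item.gain] using hx.2 y hfeas
  have hcap := (feasible_meanProgram_iff hμ).1 hx.1 k
  simp only [hload, he, Nat.cast_zero, add_zero] at hcap
  have : (B - 1) * μ ≤ accepted x * μ := by
    gcongr
    linarith [(h.gain_mem_Icc ξ (x 0)).2]
  linarith

theorem totalReward_le_of_excess [Fintype Ξ] [Nonempty J] [Fintype K] {μ : ℝ}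
    (hμ : ∀ j k, P.meanItem.use j k = μ) (hμ0 : 0 ≤ μ) (hμ1 : μ < 1) {s : Solver J K}
    (hs : s.IsExact) (B : ℕ) (n : ℕ) (e : K → ℕ) {ω : Fin n → Ξ × Option J}
    (hω : ω ∈ (P.resolve P.meanForecast s n fun k => B * μ + e k).support) :
    P.totalReward ω ≤ ∑ k, (e k : ℝ) + B := by
  induction n generalizing e with
  | zero =>
    simp only [totalReward, Finset.univ_eq_empty, Finset.sum_empty]
    positivity
  | succ n ih =>
    rcases lt_or_ge n B with hn | hn
    · calc P.totalReward ω ≤ (n + 1 : ℕ) := h.totalReward_le ω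
        _ ≤ B := by exact_mod_cast hn
        _ ≤ ∑ k, (e k : ℝ) + B := le_add_of_nonneg_left (by positivity)
    obtain ⟨ξ, -, x, hx, ω', hω', rfl⟩ := mem_support_resolve_meanForecast_succ.1 hω
    have hopt : IsOptimal (P.meanProgram ξ n) (fun k => B * μ + e k) x :=
      hs _ _ _ ⟨_, feasible_none _ fun k => by positivity⟩ x hx
    choose l hl using h.exists_load_eq_natCast ξ (x 0)
    have hle (k : K) : l k ≤ e k := by
      have := h.load_le_of_isOptimal hμ hμ0 hμ1 hn hopt k
      rw [hl] at this
      exact_mod_cast this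
    have hcapacity : (fun k => B * μ + e k - (P.item ξ).load (x 0) k) =
        fun k => B * μ + (e k - l k : ℕ) := by
      funext k
      rw [hl, Nat.cast_sub (hle k), add_sub_assoc]
    rw [hcapacity] at hω'
    have hrest := ih (fun k => e k - l k) hω'
    have hgain := h.gain_le_sum_load ξ (x 0)
    simp only [Nat.cast_sub (hle _), Finset.sum_sub_distrib] at hrest
    simp only [hl] at hgain
    rw [totalReward_cons]
    linarith

/-- The forecast items alone can exhaust the capacity. -/
theorem exists_isOptimal_reject [Fintype Ξ] [Nonempty J] {μ : ℝ}
    (hμ : ∀ j k, P.meanItem.use j k = μ) (hμ0 : 0 < μ) (hμ1 : μ ≤ 1) {C : ℝ} (hC : 0 ≤ C)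
    (hn : ⌊C / μ⌋₊ ≤ n) (ξ : Ξ) :
    ∃ y, IsOptimal (P.meanProgram ξ n) (fun _ => C) y ∧ y 0 = none := by
  obtain ⟨y, hy0, hy⟩ := exists_reject_accepted_eq (J := J) hn
  have hfeas : Feasible (P.meanProgram ξ n) (fun _ => C) y := by
    refine (feasible_meanProgram_iff hμ).2 fun k => ?_
    have := (le_div_iff₀ hμ0).1 (Nat.floor_le (a := C / μ) (by positivity))
    simpa [hy0, hy, Item.load] using this
  refine ⟨y, ⟨hfeas, fun z hz => ?_⟩, hy0⟩
  have hz := (feasible_meanProgram_iff hμ).1 hz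
  have hacc : (P.item ξ).gain (z 0) + accepted z ≤ (⌊C / μ⌋₊ : ℝ) := by
    have hfloor (m : ℕ) (hm : m * μ ≤ C) : (m : ℝ) ≤ (⌊C / μ⌋₊ : ℝ) :=
      Nat.cast_le.2 (Nat.le_floor ((le_div_iff₀ hμ0).2 hm))
    obtain ⟨k, hk⟩ := h.exists_gain_eq_load ξ (z 0)
    rcases h.load_eq_zero_or_one ξ (z 0) k with hload | hload
    · simpa [hk, hload] using hfloor (accepted z) (by simpa [hload] using hz k)
    · have := hfloor (1 + accepted z) (by push_cast; linarith [hload ▸ hz k])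
      simpa [hk, hload] using this
  simpa [h.totalGain_meanProgram, hy0, hy, Item.gain] using hacc

theorem totalReward_le_of_prefersRejection [Fintype Ξ] [Nonempty J] {μ : ℝ}
    (hμ : ∀ j k, P.meanItem.use j k = μ) (hμ0 : 0 < μ) (hμ1 : μ ≤ 1) {C : ℝ} (hC : 0 ≤ C)
    {s : Solver J K} (hs : s.PrefersRejection) (n : ℕ) {ω : Fin n → Ξ × Option J}
    (hω : ω ∈ (P.resolve P.meanForecast s n fun _ => C).support) :
    P.totalReward ω ≤ C / μ := by
  induction n with
  | zero =>
    simp only [totalReward, Finset.univ_eq_empty, Finset.sum_empty]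
    positivity
  | succ n ih =>
    rcases lt_or_ge n ⌊C / μ⌋₊ with hn | hn
    · calc P.totalReward ω ≤ (n + 1 : ℕ) := h.totalReward_le ω
        _ ≤ (⌊C / μ⌋₊ : ℝ) := by exact_mod_cast hn
        _ ≤ C / μ := Nat.floor_le (by positivity)
    obtain ⟨ξ, -, x, hx, ω', hω', rfl⟩ := mem_support_resolve_meanForecast_succ.1 hω
    have hreject : x 0 = none :=
      hs n _ _ (h.exists_isOptimal_reject hμ hμ0 hμ1 hC hn ξ) x hx
    simp only [hreject, Item.load, sub_zero] at hω'
    simpa [totalReward_cons, hreject, Item.gain] using ih hω'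

theorem one_le_totalReward [Nonempty J] {forecast : (n : ℕ) → PMF (Fin n → Item J K)}
    {s : Solver J K} (hs : s.IsExact) {c : K → ℝ} (hc : ∀ k, 1 ≤ c k) (n : ℕ)
    {ω : Fin (n + 1) → Ξ × Option J} (hω : ω ∈ (P.resolve forecast s (n + 1) c).support) :
    1 ≤ P.totalReward ω := by
  induction n with
  | zero =>
    obtain ⟨ξ, -, f, -, x, hx, ω', -, rfl⟩ := (P.mem_support_resolve_succ).1 hω
    have hopt : IsOptimal (Fin.cons (P.item ξ) f : Fin 1 → Item J K) c x :=
      hs _ _ _ ⟨_, feasible_none _ fun k => zero_le_one.trans (hc k)⟩ x hx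
    obtain ⟨j⟩ := ‹Nonempty J›
    have haccept : Feasible (Fin.cons (P.item ξ) f : Fin 1 → Item J K) c fun _ => some j :=
      fun k => by simpa [Item.load] using (h.use_mem_Icc ξ j k).2.trans (hc k)
    have hle := hopt.2 _ haccept
    simpa [totalReward, totalGain, Item.gain, h.reward_eq_one] using hle
  | succ n ih =>
    obtain ⟨ξ, -, f, -, x, -, ω', hω', rfl⟩ := (P.mem_support_resolve_succ).1 hω
    rw [totalReward_cons]
    cases hx : x 0 with
    | none => simpa [hx, Item.load, Item.gain] using ih (by simpa [hx, Item.load] using hω')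
    | some j => simpa [Item.gain, h.reward_eq_one] using h.totalReward_nonneg ω'

end IsBinaryPacking

end Problem

end CertaintyEquivalent

section KnapsackCertaintyEquivalent

variable {d T : ℕ} {hT : d ^ 2 < T}

/-- The expected consumption of each resource by an item of the knapsack. -/
noncomputable def meanUse (d T : ℕ) : ℝ :=
  1 - (d - 1) / √(T : ℝ)

theorem meanUse_pos (hT : d ^ 2 < T) : 0 < meanUse d T := by
  rw [meanUse, sub_pos, div_lt_one (sqrt_horizon_pos hT)]
  linarith [lt_sqrt_horizon hT]

theorem meanUse_lt_one (hd : 1 < d) (hT : d ^ 2 < T) : meanUse d T < 1 :=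
  sub_lt_self 1 (div_pos (sub_pos.2 (by exact_mod_cast hd)) (sqrt_horizon_pos hT))

theorem sqrt_mul_meanUse (hT : d ^ 2 < T) : √(T : ℝ) * meanUse d T = √(T : ℝ) - (d - 1) := by
  rw [meanUse, mul_sub, mul_one, mul_div_cancel₀ _ (sqrt_horizon_pos hT).ne']

theorem knapsack_meanItem_use (u : Unit) (k : Fin d) :
    (knapsack d T hT).meanItem.use u k = meanUse d T := by
  simp only [Problem.meanItem, knapsack, expect_scenarioLaw, meanUse, mul_ite, mul_one, mul_zero,
    Finset.sum_ite_eq, Finset.mem_univ, if_true]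
  ring

theorem knapsack_ceValue_le_of_isSquare (hd : 1 < d) {s : Solver Unit (Fin d)} (hs : s.IsExact)
    (hsquare : IsSquare T) : (knapsack d T hT).ceValue s ≤ √(T : ℝ) + d * (d - 1) := by
  obtain ⟨B, rfl⟩ := hsquare
  have hsqrt : √((B * B : ℕ) : ℝ) = B := by
    push_cast
    exact Real.sqrt_mul_self (Nat.cast_nonneg B)
  have hcapacity : (knapsack d (B * B) hT).capacity =
      fun _ => B * meanUse d (B * B) + (d - 1 : ℕ) := by
    have hmul := sqrt_mul_meanUse hT
    rw [hsqrt] at hmul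
    simp [knapsack, hmul, Nat.cast_sub hd.le]
  refine expect_le fun ω hω => ?_
  have := (knapsack_isBinaryPacking (by omega) hT).totalReward_le_of_excess knapsack_meanItem_use
    (meanUse_pos hT).le (meanUse_lt_one hd hT) hs B (B * B) (fun _ => d - 1) (hcapacity ▸ hω)
  refine this.trans_eq ?_
  rw [hsqrt, Finset.sum_const, Finset.card_univ, Fintype.card_fin, nsmul_eq_mul, Nat.cast_pred
    (by omega), add_comm]

theorem knapsack_ceValue_le_of_prefersRejection (hd : 1 < d) {s : Solver Unit (Fin d)}
    (hs : s.PrefersRejection) : (knapsack d T hT).ceValue s ≤ √(T : ℝ) + d * (d - 1) := by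
  have hd1 : (1 : ℝ) < d := by exact_mod_cast hd
  have hmul := sqrt_mul_meanUse hT
  have hone : 1 ≤ d * meanUse d T := by
    refine le_of_mul_le_mul_left ?_ (sqrt_horizon_pos hT)
    rw [mul_left_comm, hmul]
    nlinarith [lt_sqrt_horizon hT]
  calc (knapsack d T hT).ceValue s ≤ √(T : ℝ) / meanUse d T :=
        expect_le fun ω hω =>
          (knapsack_isBinaryPacking (by omega) hT).totalReward_le_of_prefersRejection
            knapsack_meanItem_use (meanUse_pos hT) (meanUse_lt_one hd hT).le (Real.sqrt_nonneg _)
            hs T hω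
    _ ≤ √(T : ℝ) + d * (d - 1) := by
        rw [div_le_iff₀ (meanUse_pos hT), add_mul, hmul]
        nlinarith

theorem knapsack_ceValue_le (hd : 1 < d) {s : Solver Unit (Fin d)} (hs : s.IsExact)
    (h : IsSquare T ∨ s.PrefersRejection) :
    (knapsack d T hT).ceValue s ≤ √(T : ℝ) + d * (d - 1) :=
  h.elim (knapsack_ceValue_le_of_isSquare hd hs) (knapsack_ceValue_le_of_prefersRejection hd)

theorem knapsack_ceValue_pos (hd : 0 < d) {s : Solver Unit (Fin d)} (hs : s.IsExact) :
    0 < (knapsack d T hT).ceValue s := by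
  obtain ⟨n, rfl⟩ := Nat.exists_eq_succ_of_ne_zero (Nat.ne_zero_of_lt hT)
  exact zero_lt_one.trans_le (le_expect fun ω hω =>
    (knapsack_isBinaryPacking hd hT).one_le_totalReward hs (fun _ => one_le_sqrt_horizon hT) n hω)

end KnapsackCertaintyEquivalent

section Comparison

theorem exists_forall_lt_mul_sqrt {δ : ℝ} (hδ : 0 < δ) (a b : ℝ) :
    ∃ T₀ : ℕ, ∀ T : ℕ, T₀ ≤ T → a * √√(T : ℝ) + b < δ * √(T : ℝ) := by
  have htendsto : Filter.Tendsto (fun T : ℕ => √√(T : ℝ)) Filter.atTop Filter.atTop :=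
    Real.tendsto_sqrt_atTop.comp (Real.tendsto_sqrt_atTop.comp tendsto_natCast_atTop_atTop)
  refine Filter.eventually_atTop.1 ?_
  filter_upwards [htendsto.eventually_ge_atTop 1,
    htendsto.eventually_gt_atTop ((|a| + |b|) / δ)] with T hone hlarge
  rw [div_lt_iff₀ hδ] at hlarge
  calc a * √√(T : ℝ) + b ≤ (|a| + |b|) * √√(T : ℝ) := by
        nlinarith [le_abs_self a, le_abs_self b, abs_nonneg b]
    _ < √√(T : ℝ) * δ * √√(T : ℝ) := by gcongr
    _ = δ * √(T : ℝ) := by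
        rw [mul_right_comm, Real.mul_self_sqrt (Real.sqrt_nonneg _), mul_comm]

theorem exists_forall_mul_ceValue_le_osoValue {d : ℕ} (hd : 1 < d) {M : ℝ} (hM : M < d) :
    ∃ T₀ : ℕ, ∀ (T : ℕ) (hT : d ^ 2 < T), T₀ ≤ T → ∀ s s' : Solver Unit (Fin d),
      s.IsExact → s.IsEquivariant → s'.IsExact → (IsSquare T ∨ s'.PrefersRejection) →
        M * (knapsack d T hT).ceValue s' ≤ (knapsack d T hT).osoValue s := by
  have hd0 : 0 < d := by omega
  obtain ⟨T₀, h⟩ := exists_forall_lt_mul_sqrt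
    (sub_pos.2 (max_lt hM (Nat.cast_pos.2 hd0 : (0 : ℝ) < d))) (12 * d) (max M 0 * (d * (d - 1)))
  refine ⟨T₀, fun T hT hT₀ s s' hs hs_equivariant hs' hs'_reject => ?_⟩
  calc M * (knapsack d T hT).ceValue s' ≤ max M 0 * (√(T : ℝ) + d * (d - 1)) :=
        mul_le_mul (le_max_left _ _) (knapsack_ceValue_le hd hs' hs'_reject)
          (knapsack_ceValue_pos hd0 hs').le (le_max_right _ _)
    _ ≤ d * (√(T : ℝ) - 12 * √√(T : ℝ)) := by linarith [h T hT₀]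
    _ ≤ _ := le_knapsack_osoValue hd0 hs hs_equivariant

theorem exists_forall_ceValue_lt_optExpected {d : ℕ} (hd : 1 < d) {ρ : ℝ} (hρ : 1 / (d : ℝ) < ρ)
    (α : ℝ) :
    ∃ T₀ : ℕ, ∀ (T : ℕ) (hT : d ^ 2 < T), T₀ ≤ T → ∀ s : Solver Unit (Fin d),
      s.IsExact → (IsSquare T ∨ s.PrefersRejection) →
        (knapsack d T hT).ceValue s < ρ * (knapsack d T hT).optExpected - α := by
  have hd0 : (0 : ℝ) < d := Nat.cast_pos.2 (by omega)
  have hρ0 : 0 < ρ := (one_div_pos.2 hd0).trans hρ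
  obtain ⟨T₀, h⟩ := exists_forall_lt_mul_sqrt (sub_pos.2 ((div_lt_iff₀ hd0).1 hρ)) (ρ * d)
    (ρ * d + α + d * (d - 1))
  refine ⟨T₀, fun T hT hT₀ s hs hs_reject => ?_⟩
  calc (knapsack d T hT).ceValue s ≤ √(T : ℝ) + d * (d - 1) := knapsack_ceValue_le hd hs hs_reject
    _ < ρ * (d * (√(T : ℝ) - √√(T : ℝ) - 1)) - α := by linarith [h T hT₀]
    _ ≤ ρ * (knapsack d T hT).optExpected - α := by
        gcongr
        exact le_knapsack_optExpected

variable {d T : ℕ} {hT : d ^ 2 < T}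

theorem log_two_le_log_mul (hd : 0 < d) (hT : d ^ 2 < T) : Real.log 2 ≤ Real.log (d * T) := by
  have hT2 : 2 ≤ T := by nlinarith
  refine Real.log_le_log (by norm_num) ?_
  exact_mod_cast hT2.trans (Nat.le_mul_of_pos_left T hd)

theorem competitive_knapsack_osoValue (hd : 0 < d) {s : Solver Unit (Fin d)} (hs : s.IsExact)
    (hs' : s.IsEquivariant) :
    (1 - 15 * √(Real.log (d * T) / √(T : ℝ))) * (knapsack d T hT).optExpected ≤
      (knapsack d T hT).osoValue s := by
  have h := knapsack_isBinaryPacking hd hT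
  set L := Real.log (d * T)
  rcases le_total (1 - 15 * √(L / √(T : ℝ))) 0 with hneg | hpos
  · exact (mul_nonpos_of_nonpos_of_nonneg hneg (h.optFrom_nonneg _ _)).trans
      (h.valueFrom_nonneg _ _ _ _)
  have hloss : 12 * √√(T : ℝ) ≤ 15 * √(L / √(T : ℝ)) * √(T : ℝ) := by
    have hL : (4 / 5 : ℝ) ≤ √L := Real.le_sqrt_of_sq_le <| by
      linarith [log_two_le_log_mul hd hT, Real.log_two_gt_d9]
    have hsqrt : √(L / √(T : ℝ)) * √(T : ℝ) = √L * √√(T : ℝ) := by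
      rw [Real.sqrt_div' _ (Real.sqrt_nonneg _), div_mul_eq_mul_div, mul_div_assoc, Real.div_sqrt]
    rw [mul_assoc, hsqrt]
    nlinarith [Real.sqrt_nonneg √(T : ℝ)]
  calc _ ≤ (1 - 15 * √(L / √(T : ℝ))) * (d * √(T : ℝ)) := by
        gcongr
        exact knapsack_optExpected_le hd
    _ = d * (√(T : ℝ) - 15 * √(L / √(T : ℝ)) * √(T : ℝ)) := by ring
    _ ≤ d * (√(T : ℝ) - 12 * √√(T : ℝ)) := by gcongr
    _ ≤ _ := le_knapsack_osoValue hd hs hs'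

theorem le_log_pow_three {ε : ℝ} (hε : 0 < ε) (hε' : ε ≤ 1 / 2) :
    225 ≤ 1024 * Real.log (1 / ε) ^ 3 := by
  have hlog : 0.69 ≤ Real.log (1 / ε) := by
    have : Real.log 2 ≤ Real.log (1 / ε) :=
      Real.log_le_log (by norm_num) ((le_one_div (by norm_num) hε).2 hε')
    linarith [Real.log_two_gt_d9]
  calc (225 : ℝ) ≤ 1024 * 0.69 ^ 3 := by norm_num
    _ ≤ 1024 * Real.log (1 / ε) ^ 3 := by gcongr

theorem competitive_knapsack_osoValue_of_le (hd : 0 < d) {ε : ℝ} (hε : 0 < ε) (hε' : ε ≤ 1 / 2)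
    (h : 1024 * Real.log (2 * d * T / ε) * (Real.log (1 / ε) ^ 3 / ε ^ 2) ≤ √(T : ℝ))
    {s : Solver Unit (Fin d)} (hs : s.IsExact) (hs' : s.IsEquivariant) :
    (1 - ε) * (knapsack d T hT).optExpected ≤ (knapsack d T hT).osoValue s := by
  refine le_trans ?_ (competitive_knapsack_osoValue hd hs hs')
  have hB0 := sqrt_horizon_pos hT
  have hdT : (0 : ℝ) < d * T := by
    exact_mod_cast Nat.mul_pos hd ((Nat.zero_le _).trans_lt hT)
  have hlog : Real.log (d * T) ≤ Real.log (2 * d * T / ε) := by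
    refine Real.log_le_log hdT ?_
    rw [le_div_iff₀ hε]
    nlinarith
  have hcube := le_log_pow_three hε hε'
  have hlog0 : 0 ≤ Real.log (d * T) :=
    (Real.log_nonneg one_le_two).trans (log_two_le_log_mul hd hT)
  have hcapacity : 225 * Real.log (d * T) ≤ √(T : ℝ) * ε ^ 2 :=
    calc 225 * Real.log (d * T)
        ≤ 1024 * Real.log (1 / ε) ^ 3 * Real.log (2 * d * T / ε) := by gcongr
      _ = 1024 * Real.log (2 * d * T / ε) * (Real.log (1 / ε) ^ 3 / ε ^ 2) * ε ^ 2 := by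
          field_simp
      _ ≤ √(T : ℝ) * ε ^ 2 := by gcongr
  have hrate : √(Real.log (d * T) / √(T : ℝ)) ≤ ε / 15 := by
    rw [Real.sqrt_le_left (by positivity), div_le_iff₀ hB0]
    linarith
  have := (knapsack_isBinaryPacking hd hT).optFrom_nonneg T (knapsack d T hT).capacity
  refine mul_le_mul_of_nonneg_right ?_ this
  linarith

end Comparison

end OnlineAllocation

open OnlineAllocation in
theorem proposition2_general :
    (∀ d : ℕ, 1 < d → ∀ M : ℝ, M < d → ∃ T₀ : ℕ,
      ∀ (T : ℕ) (hT : d ^ 2 < T), T₀ ≤ T → ∀ s s' : Solver Unit (Fin d),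
        s.IsExact → s.IsEquivariant → s'.IsExact → (IsSquare T ∨ s'.PrefersRejection) →
          0 < (knapsack d T hT).ceValue s' ∧
          M * (knapsack d T hT).ceValue s' ≤ (knapsack d T hT).osoValue s) ∧
    (∀ d : ℕ, 1 < d → ∀ ρ : ℝ, 1 / (d : ℝ) < ρ → ∀ α : ℝ, ∃ T₀ : ℕ,
      ∀ (T : ℕ) (hT : d ^ 2 < T), T₀ ≤ T → ∀ s : Solver Unit (Fin d),
        s.IsExact → (IsSquare T ∨ s.PrefersRejection) →
          (knapsack d T hT).ceValue s < ρ * (knapsack d T hT).optExpected - α) ∧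
    (∀ (d T : ℕ) (hT : d ^ 2 < T), 0 < d → ∀ ε : ℝ, 0 < ε → ε ≤ 1 / 2 →
      1024 * Real.log (2 * d * T / ε) * (Real.log (1 / ε) ^ 3 / ε ^ 2) ≤ √(T : ℝ) →
      ∀ s : Solver Unit (Fin d), s.IsExact → s.IsEquivariant →
        (1 - ε) * (knapsack d T hT).optExpected ≤ (knapsack d T hT).osoValue s) ∧
    (∃ C : ℝ, 0 < C ∧ ∀ (d T : ℕ) (hT : d ^ 2 < T), 0 < d →
      ∀ s : Solver Unit (Fin d), s.IsExact → s.IsEquivariant →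
        (1 - C * √(Real.log (d * T) / √(T : ℝ))) * (knapsack d T hT).optExpected ≤
          (knapsack d T hT).osoValue s) := by
  refine ⟨fun d hd M hM => ?_, fun d hd ρ hρ α => exists_forall_ceValue_lt_optExpected hd hρ α,
    fun d T hT hd ε hε hε' h s hs hs' => competitive_knapsack_osoValue_of_le hd hε hε' h hs hs',
    15, by norm_num, fun d T hT hd s hs hs' => competitive_knapsack_osoValue hd hs hs'⟩
  obtain ⟨T₀, h⟩ := exists_forall_mul_ceValue_le_osoValue hd hM
  exact ⟨T₀, fun T hT hT₀ s s' hs hse hs' hs'' =>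
    ⟨knapsack_ceValue_pos (by omega) hs', h T hT hT₀ s s' hs hse hs' hs''⟩⟩

theorem proposition2 :
    -- OSO beats CE by any factor `M < d` for all large `T`, hence by arbitrarily large factors
    (∀ d : ℕ, 2 < d → ∀ M : ℝ, M < d → ∃ T₀ : ℕ,
      ∀ (T : ℕ) (hT : d ^ 2 < T), T₀ ≤ T → ∀ s s' : OnlineAllocation.Solver Unit (Fin d),
        s.IsExact → s.IsEquivariant → s'.IsExact → (IsSquare T ∨ s'.PrefersRejection) →
          0 < (OnlineAllocation.knapsack d T hT).ceValue s' ∧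
          M * (OnlineAllocation.knapsack d T hT).ceValue s' ≤
            (OnlineAllocation.knapsack d T hT).osoValue s) ∧
    -- the competitive ratio of CE is at most `1 / d`
    (∀ d : ℕ, 2 < d → ∀ ρ : ℝ, 1 / (d : ℝ) < ρ → ∀ α : ℝ, ∃ T₀ : ℕ,
      ∀ (T : ℕ) (hT : d ^ 2 < T), T₀ ≤ T → ∀ s : OnlineAllocation.Solver Unit (Fin d),
        s.IsExact → (IsSquare T ∨ s.PrefersRejection) →
          (OnlineAllocation.knapsack d T hT).ceValue s <
            ρ * (OnlineAllocation.knapsack d T hT).optExpected - α) ∧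
    -- OSO achieves `1 - ε` as soon as the capacity exceeds a threshold
    (∀ (d T : ℕ) (hT : d ^ 2 < T), 2 < d → ∀ ε : ℝ, 0 < ε → ε ≤ 0.001 →
      1024 * Real.log (2 * d * T / ε) * (Real.log (1 / ε) ^ 3 / ε ^ 2) ≤ √(T : ℝ) →
      ∀ s : OnlineAllocation.Solver Unit (Fin d), s.IsExact → s.IsEquivariant →
        (1 - ε) * (OnlineAllocation.knapsack d T hT).optExpected ≤
          (OnlineAllocation.knapsack d T hT).osoValue s) ∧
    -- OSO achieves `1 - O(√(log (d T) / B))` with `B = √T`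
    (∃ C : ℝ, 0 < C ∧ ∀ (d T : ℕ) (hT : d ^ 2 < T), 2 < d →
      ∀ s : OnlineAllocation.Solver Unit (Fin d), s.IsExact → s.IsEquivariant →
        (1 - C * √(Real.log (d * T) / √(T : ℝ))) *
            (OnlineAllocation.knapsack d T hT).optExpected ≤
          (OnlineAllocation.knapsack d T hT).osoValue s) := by
  obtain ⟨hratio, hce, hoso, C, hC, hrate⟩ := proposition2_general
  exact ⟨fun d hd => hratio d (by omega), fun d hd => hce d (by omega),
    fun d T hT hd ε hε hε' => hoso d T hT (by omega) ε hε (by linarith),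
    C, hC, fun d T hT hd => hrate d T hT (by omega)⟩
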